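/- Let $k$ be a finite field with $q=|k|$ elements, let $\widetilde Q$ be a finite acyclic quiver with vertex set $\{1,\dots,m\}$, let $n\le m$, and let $Q$ be the full subquiver of $\widetilde Q$ on $\{1,\dots,n\}$ (the vertices $n+1,\dots,m$ are frozen). Modules are finite-dimensional, with conventions such that $\dim_k\mathrm{Ext}^1_{k\widetilde Q}(S_i,S_j)$ is the number of arrows $j\to i$, where $S_i$ is the simple module at the vertex $i$. Define $m\times n$ integer matrices $\widetilde B,\widetilde R,\widetilde I$ by $$b_{ij}=|\{\text{arrows } i\to j\}|-|\{\text{arrows } j\to i\}|,\qquad \widetilde r_{ij}=\dim_k\mathrm{Ext}^1_{k\widetilde Q}(S_i,S_j),\qquad \widetilde I=\begin{bmatrix}I_n\\0\end{bmatrix},$$ and let $\Lambda$ be a skew-symmetric $m\times m$ integer matrix with $\Lambda(-\widetilde B)=\widetilde I$; write $\Lambda(a,b)=a^{tr}\Lambda b$ for $a,b\in\mathbb Z^m$. Let $\mathcal T$ be the based quantum torus over $\mathbb Z[q^{\pm1/2}]\subset\mathbb R$: the $\mathbb Z[q^{\pm1/2}]$-algebra with basis $\{X^a: a\in\mathbb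 Z^m\}$ and multiplication $X^aX^b=q^{\frac12\Lambda(a,b)}X^{a+b}$. For $kQ$-modules $M,N$ put $[M,N]=\dim_k\mathrm{Hom}_{kQ}(M,N)$ and $[M,N]^1=\dim_k\mathrm{Ext}^1_{kQ}(M,N)$, and let $\langle\ ,\ \rangle$ be the Euler form, i.e. the bilinear form on $\mathbb Z^n$ with $\langle\underline{\dim}M,\underline{\dim}N\rangle=[M,N]-[M,N]^1$. For a $kQ$-module $M$ with dimension vector $\underline m\in\mathbb Z^n$, define the quantum Caldero–Chapoton element $$X_M=\sum_{\underline e}|\mathrm{Gr}_{\underline e}M|\,q^{-\frac12\langle\underline e,\underline m-\underline e\rangle}X^{\widetilde B\underline e-(\widetilde I-\widetilde R)\underline m}\in\mathcal T,$$ where $\mathrm{Gr}_{\underline e}M$ is the set of submodules of $M$ with dimension vector $\underline e$. For $kQ$-modules $M,N,E$ let $\varepsilon_{MN}^E$ be the number of elements of $\mathrm{Ext}^1_{kQ}(M,N)$ that are classes of short exact sequences $0\to N\to E'\to M\to 0$ with $E'\cong E$. Then for all $kQ$-modules $M$ and $N$, with dimension vectors $\underline m$ and $\underline n$, $$q^{[M,N]^1}X_NX_M=q^{-\frac12\Lambda((\widetilde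 I-\widetilde R)\underline m,(\widetilde I-\widetilde R)\underline n)}\sum_E\varepsilon_{MN}^E\,X_E ,$$ where $E$ runs over the isomorphism classes of $kQ$-modules. -/

import Mathlib

open CategoryTheory CategoryTheory.Abelian
open scoped Matrix ModuleCat

set_option linter.unusedSectionVars false

universe u

namespace QuantumCC

noncomputable section

/-! ### The path algebra of a finite quiver -/

/-- The path algebra `kV` of a quiver `V`: the `k`-vector space with basis the paths of `V`. -/
def PathAlgebra (k V : Type u) [Field k] [Quiver.{u} V] : Type u :=
  (Σ i j : V, Quiver.Path i j) →₀ k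

namespace PathAlgebra

section Basic

variable (k V : Type u) [Field k] [Quiver.{u} V]

instance : AddCommGroup (PathAlgebra k V) :=
  inferInstanceAs (AddCommGroup ((Σ i j : V, Quiver.Path i j) →₀ k))

instance : Module k (PathAlgebra k V) :=
  inferInstanceAs (Module k ((Σ i j : V, Quiver.Path i j) →₀ k))

/-- The basis of the path algebra given by all paths. -/
def basis : Module.Basis (Σ i j : V, Quiver.Path i j) k (PathAlgebra k V) :=
  Module.Basis.ofRepr (LinearEquiv.refl k _)

variable {V} in
/-- The basis element of the path algebra given by a path. -/
def ofPath {i j : V} (p : Quiver.Path i j) : PathAlgebra k V :=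
  basis k V ⟨i, j, p⟩

variable {k V} in
theorem induction_on {motive : PathAlgebra k V → Prop} (x : PathAlgebra k V)
    (zero : motive 0) (add : ∀ y z, motive y → motive z → motive (y + z))
    (smul : ∀ (c : k) {i j : V} (p : Quiver.Path i j), motive (c • ofPath k p)) : motive x := by
  rw [← (basis k V).linearCombination_repr x, Finsupp.linearCombination_apply]
  exact Finset.sum_induction _ motive add zero fun p _ => smul _ p.2.2

variable [DecidableEq V]

variable {V} in
/-- The product of two paths: "first `p`, then `q`" if `p` ends where `q` starts, and zero
otherwise.  With this order of composition an arrow `i ⟶ j` acts on a left module `M` as a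
linear map `e_j M → e_i M`, so that `dim Ext¹(S_i, S_j)` is the number of arrows `j ⟶ i`. -/
def pathMul (p q : Σ i j : V, Quiver.Path i j) : PathAlgebra k V :=
  if h : p.2.1 = q.1 then ofPath k (p.2.2.comp (q.2.2.cast h.symm rfl)) else 0

/-- The multiplication of the path algebra, the bilinear extension of the product of paths. -/
def mulLin : PathAlgebra k V →ₗ[k] PathAlgebra k V →ₗ[k] PathAlgebra k V :=
  (basis k V).constr k fun p => (basis k V).constr k fun q => pathMul k p q

instance : Mul (PathAlgebra k V) := ⟨fun x y => mulLin k V x y⟩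

variable {k V}

theorem mul_def (x y : PathAlgebra k V) : x * y = mulLin k V x y := rfl

theorem ofPath_mul {i j l : V} (p : Quiver.Path i j) (q : Quiver.Path j l) :
    ofPath k p * ofPath k q = ofPath k (p.comp q) := by
  simp [mul_def, mulLin, ofPath, pathMul]

theorem ofPath_mul_of_ne {i j j' l : V} (p : Quiver.Path i j) (q : Quiver.Path j' l)
    (h : j ≠ j') : ofPath k p * ofPath k q = 0 := by
  simp [mul_def, mulLin, ofPath, pathMul, h]

theorem mul_add' (x y z : PathAlgebra k V) : x * (y + z) = x * y + x * z := by
  simp [mul_def]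

theorem add_mul' (x y z : PathAlgebra k V) : (x + y) * z = x * z + y * z := by
  simp [mul_def]

theorem zero_mul' (x : PathAlgebra k V) : 0 * x = 0 := by simp [mul_def]

theorem mul_zero' (x : PathAlgebra k V) : x * 0 = 0 := by simp [mul_def]

theorem smul_mul' (c : k) (x y : PathAlgebra k V) : c • x * y = c • (x * y) := by
  simp [mul_def]

theorem mul_smul' (c : k) (x y : PathAlgebra k V) : x * c • y = c • (x * y) := by
  simp [mul_def]

theorem mul_assoc' (x y z : PathAlgebra k V) : x * y * z = x * (y * z) := by
  induction x using induction_on with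
  | zero => simp only [zero_mul']
  | add x₁ x₂ h₁ h₂ => simp only [add_mul', h₁, h₂]
  | smul a p =>
  induction y using induction_on with
  | zero => simp only [zero_mul', mul_zero']
  | add y₁ y₂ h₁ h₂ => simp only [add_mul', mul_add', h₁, h₂]
  | smul b q =>
  induction z using induction_on with
  | zero => simp only [mul_zero']
  | add z₁ z₂ h₁ h₂ => simp only [mul_add', h₁, h₂]
  | smul c r =>
  simp only [smul_mul', mul_smul']
  congr 3
  rename_i i j i' j' i'' j''
  by_cases h : j = i' <;> by_cases h' : j' = i''
  · subst h h'
    simp only [ofPath_mul, Quiver.Path.comp_assoc]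
  · subst h
    rw [ofPath_mul, ofPath_mul_of_ne _ _ h', ofPath_mul_of_ne _ _ h', mul_zero']
  · subst h'
    rw [ofPath_mul, ofPath_mul_of_ne _ _ h, ofPath_mul_of_ne _ _ h, zero_mul']
  · rw [ofPath_mul_of_ne _ _ h, ofPath_mul_of_ne _ _ h', mul_zero', zero_mul']

end Basic

section Unital

variable {k V : Type u} [Field k] [Quiver.{u} V] [DecidableEq V]

variable (k) in
/-- The idempotent `e_i`, the path of length zero at `i`. -/
def e (i : V) : PathAlgebra k V := ofPath k (Quiver.Path.nil : Quiver.Path i i)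

variable [Fintype V]

instance : One (PathAlgebra k V) := ⟨∑ i : V, e k i⟩

theorem one_def : (1 : PathAlgebra k V) = ∑ i : V, e k i := rfl

theorem one_mul' (x : PathAlgebra k V) : 1 * x = x := by
  induction x using induction_on with
  | zero => rw [mul_zero']
  | add y z hy hz => rw [mul_add', hy, hz]
  | @smul c i j p =>
    rw [mul_smul', one_def, mul_def, map_sum, LinearMap.sum_apply,
      Finset.sum_eq_single i]
    · rw [← mul_def, e, ofPath_mul, Quiver.Path.nil_comp]
    · intro l _ hl
      exact ofPath_mul_of_ne _ _ hl
    · simp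

theorem mul_one' (x : PathAlgebra k V) : x * 1 = x := by
  induction x using induction_on with
  | zero => rw [zero_mul']
  | add y z hy hz => rw [add_mul', hy, hz]
  | @smul c i j p =>
    rw [smul_mul', one_def, mul_def, map_sum, Finset.sum_eq_single j]
    · rw [← mul_def, e, ofPath_mul, Quiver.Path.comp_nil]
    · intro l _ hl
      exact ofPath_mul_of_ne _ _ hl.symm
    · simp

instance : Ring (PathAlgebra k V) where
  __ := (inferInstance : AddCommGroup (PathAlgebra k V))
  left_distrib := mul_add'
  right_distrib := add_mul'
  zero_mul := zero_mul'
  mul_zero := mul_zero'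
  mul_assoc := mul_assoc'
  one_mul := one_mul'
  mul_one := mul_one'

instance : Algebra k (PathAlgebra k V) := Algebra.ofModule smul_mul' mul_smul'

end Unital

end PathAlgebra

/-! ### Finite-dimensional modules, dimension vectors, simple modules, Euler form -/

section Modules

variable (k V : Type u) [Field k] [Quiver.{u} V] [DecidableEq V] [Fintype V]

/-- The property of being a finite-dimensional (left) `kV`-module. -/
def finDim : ObjectProperty (ModuleCat.{u} (PathAlgebra k V)) := fun M => Module.Finite k M

/-- The category of finite-dimensional (left) `kV`-modules. -/
abbrev FDMod : Type (u + 1) := (finDim k V).FullSubcategory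

/-- The isomorphism classes of finite-dimensional `kV`-modules. -/
abbrev IsoClass : Type (u + 1) := Quotient (isIsomorphicSetoid (FDMod k V))

variable {k V}

/-- The dimension vector of a `kV`-module `M`, with entries `dim_k e_i M`. -/
def dimVec (M : ModuleCat.{u} (PathAlgebra k V)) (i : V) : ℕ :=
  Module.finrank k (LinearMap.range (Algebra.lsmul k k M (PathAlgebra.e k i)))

variable (k) in
/-- The linear form on `kV` sending `e_i` to `1` and all other paths to `0`. -/
def simpleForm (i : V) : PathAlgebra k V →ₗ[k] k :=
  (PathAlgebra.basis k V).constr k fun p => if p.1 = i ∧ p.2.2.length = 0 then 1 else 0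

theorem simpleForm_ofPath (i : V) {a b : V} (p : Quiver.Path a b) :
    simpleForm k i (PathAlgebra.ofPath k p) = if a = i ∧ p.length = 0 then 1 else 0 := by
  simp [simpleForm, PathAlgebra.ofPath]

theorem simpleForm_one (i : V) : simpleForm k i 1 = 1 := by
  simp [PathAlgebra.one_def, PathAlgebra.e, simpleForm_ofPath]

theorem simpleForm_mul (i : V) (x y : PathAlgebra k V) :
    simpleForm k i (x * y) = simpleForm k i x * simpleForm k i y := by
  induction x using PathAlgebra.induction_on with
  | zero => simp
  | add x₁ x₂ h₁ h₂ => simp only [add_mul, map_add, h₁, h₂]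
  | smul c p =>
  induction y using PathAlgebra.induction_on with
  | zero => simp
  | add y₁ y₂ h₁ h₂ => simp only [mul_add, map_add, h₁, h₂]
  | smul d q =>
  rename_i a b a' b'
  simp only [smul_mul_assoc, mul_smul_comm, map_smul, smul_eq_mul, simpleForm_ofPath]
  by_cases h : b = a'
  · subst h
    rw [PathAlgebra.ofPath_mul, simpleForm_ofPath, Quiver.Path.length_comp]
    by_cases hp : p.length = 0
    · obtain rfl := Quiver.Path.eq_of_length_zero p hp
      by_cases ha : a = i <;> simp [hp, ha, mul_comm]
    · simp [hp]
  · rw [PathAlgebra.ofPath_mul_of_ne _ _ h, map_zero]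
    by_cases hp : p.length = 0
    · obtain rfl := Quiver.Path.eq_of_length_zero p hp
      by_cases ha : a = i
      · have : a' ≠ i := fun h' => h (ha.trans h'.symm)
        simp [this]
      · simp [ha]
    · simp [hp]

variable (k) in
/-- The character of `kV` sending `e_i` to `1` and all other paths to `0`. -/
def simpleChar (i : V) : PathAlgebra k V →ₐ[k] k :=
  AlgHom.ofLinearMap (simpleForm k i) (simpleForm_one i) (simpleForm_mul i)

variable (k) in
/-- The simple `kV`-module `S_i` at the vertex `i`. -/
def simple (i : V) : ModuleCat.{u} (PathAlgebra k V) :=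
  (ModuleCat.restrictScalars (simpleChar k i).toRingHom).obj (ModuleCat.of k k)

/-- `[M, N] = dim_k Hom(M, N)`. -/
def homDim (M N : ModuleCat.{u} (PathAlgebra k V)) : ℕ := Module.finrank k (M ⟶ N)

/-- `[M, N]¹ = dim_k Ext¹(M, N)`. -/
def extDim (M N : ModuleCat.{u} (PathAlgebra k V)) : ℕ := Module.finrank k (Ext.{u} M N 1)

variable (k) in
/-- The Euler form on dimension vectors: the bilinear form on `ℤ^V` with
`⟨dim M, dim N⟩ = [M, N] - [M, N]¹`, given by its values on the classes of the simple modules. -/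
def eulerForm (x y : V → ℤ) : ℤ :=
  ∑ i, ∑ j, x i * y j * ((homDim (simple k i) (simple k j) : ℤ) -
    (extDim (simple k i) (simple k j) : ℤ))

/-- The set `Gr_e(M)` of submodules of `M` with dimension vector `d`. -/
def Gr (M : ModuleCat.{u} (PathAlgebra k V)) (d : V → ℕ) :
    Set (Submodule (PathAlgebra k V) M) :=
  {U | dimVec (ModuleCat.of (PathAlgebra k V) U) = d}

/-- `Ext¹(M, N)_E`: the classes of the short exact sequences `0 → N → E' → M → 0` whose middle
term `E'` is isomorphic to `E`. -/
def extWithMiddle (M N E : ModuleCat.{u} (PathAlgebra k V)) : Set (Ext.{u} M N 1) :=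
  {x | ∃ (E' : ModuleCat.{u} (PathAlgebra k V)) (f : N ⟶ E') (g : E' ⟶ M) (w : f ≫ g = 0)
    (h : (ShortComplex.mk f g w).ShortExact), Nonempty (E' ≅ E) ∧ h.extClass = x}

/-- `ε_{MN}^E`, the cardinality of `Ext¹(M, N)_E`. -/
def epsilon (M N E : ModuleCat.{u} (PathAlgebra k V)) : ℕ := (extWithMiddle M N E).ncard

end Modules

/-! ### The based quantum torus -/

/-- The based quantum torus over `R`, for the lattice `ℤ^I`, the bilinear form `Λ` and the
square root `v` of `q`: the free `R`-module with basis `X^a`, `a ∈ ℤ^I`, and the multiplication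
`X^a X^b = q^{Λ(a,b)/2} X^{a+b} = v^{Λ(a,b)} X^{a+b}`. -/
@[nolint unusedArguments]
def QuantumTorus {R : Type} [CommRing R] {I : Type u} [Fintype I] (_v : Rˣ)
    (_Λ : Matrix I I ℤ) : Type u :=
  (I → ℤ) →₀ R

/-- The bilinear form `Λ(a, b) = aᵗ Λ b`. -/
def form {I : Type u} [Fintype I] (Λ : Matrix I I ℤ) (a b : I → ℤ) : ℤ := a ⬝ᵥ Λ *ᵥ b

namespace QuantumTorus

variable {R : Type} [CommRing R] {I : Type u} [Fintype I] (v : Rˣ) (Λ : Matrix I I ℤ)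

instance : AddCommGroup (QuantumTorus v Λ) := inferInstanceAs (AddCommGroup ((I → ℤ) →₀ R))

instance : Module R (QuantumTorus v Λ) := inferInstanceAs (Module R ((I → ℤ) →₀ R))

/-- The distinguished basis of the quantum torus. -/
def basis : Module.Basis (I → ℤ) R (QuantumTorus v Λ) :=
  Module.Basis.ofRepr (LinearEquiv.refl R _)

/-- The basis element `X^a`. -/
def X (a : I → ℤ) : QuantumTorus v Λ := basis v Λ a

/-- The multiplication of the quantum torus. -/
def mulLin : QuantumTorus v Λ →ₗ[R] QuantumTorus v Λ →ₗ[R] QuantumTorus v Λ :=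
  (basis v Λ).constr R fun a => (basis v Λ).constr R fun b =>
    ((v ^ form Λ a b : Rˣ) : R) • X v Λ (a + b)

instance : Mul (QuantumTorus v Λ) := ⟨fun x y => mulLin v Λ x y⟩

instance : One (QuantumTorus v Λ) := ⟨X v Λ 0⟩

variable {v Λ}

theorem mul_def (x y : QuantumTorus v Λ) : x * y = mulLin v Λ x y := rfl

theorem one_def : (1 : QuantumTorus v Λ) = X v Λ 0 := rfl

theorem X_mul_X (a b : I → ℤ) :
    X v Λ a * X v Λ b = ((v ^ form Λ a b : Rˣ) : R) • X v Λ (a + b) := by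
  simp [mul_def, mulLin, X]

theorem induction_on {motive : QuantumTorus v Λ → Prop} (x : QuantumTorus v Λ)
    (zero : motive 0) (add : ∀ y z, motive y → motive z → motive (y + z))
    (smul : ∀ (c : R) (a : I → ℤ), motive (c • X v Λ a)) : motive x := by
  rw [← (basis v Λ).linearCombination_repr x, Finsupp.linearCombination_apply]
  exact Finset.sum_induction _ motive add zero fun p _ => smul _ p

theorem mul_add' (x y z : QuantumTorus v Λ) : x * (y + z) = x * y + x * z := by
  simp [mul_def]

theorem add_mul' (x y z : QuantumTorus v Λ) : (x + y) * z = x * z + y * z := by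
  simp [mul_def]

theorem zero_mul' (x : QuantumTorus v Λ) : 0 * x = 0 := by simp [mul_def]

theorem mul_zero' (x : QuantumTorus v Λ) : x * 0 = 0 := by simp [mul_def]

theorem smul_mul' (c : R) (x y : QuantumTorus v Λ) : c • x * y = c • (x * y) := by
  simp [mul_def]

theorem mul_smul' (c : R) (x y : QuantumTorus v Λ) : x * c • y = c • (x * y) := by
  simp [mul_def]

theorem mul_assoc' (x y z : QuantumTorus v Λ) : x * y * z = x * (y * z) := by
  induction x using induction_on with
  | zero => simp only [zero_mul']
  | add x₁ x₂ h₁ h₂ => simp only [add_mul', h₁, h₂]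
  | smul r a =>
  induction y using induction_on with
  | zero => simp only [zero_mul', mul_zero']
  | add y₁ y₂ h₁ h₂ => simp only [add_mul', mul_add', h₁, h₂]
  | smul s b =>
  induction z using induction_on with
  | zero => simp only [mul_zero']
  | add z₁ z₂ h₁ h₂ => simp only [mul_add', h₁, h₂]
  | smul t c =>
  have key : v ^ form Λ a b * v ^ form Λ (a + b) c = v ^ form Λ b c * v ^ form Λ a (b + c) := by
    rw [← zpow_add, ← zpow_add]
    congr 1
    simp only [form, Matrix.mulVec_add, dotProduct_add, add_dotProduct]
    ring
  have key' := congrArg (Units.val (α := R)) key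
  simp only [Units.val_mul] at key'
  simp only [smul_mul', mul_smul', X_mul_X, smul_smul, add_assoc]
  congr 1
  linear_combination (r * s * t) * key'

theorem one_mul' (x : QuantumTorus v Λ) : 1 * x = x := by
  induction x using induction_on with
  | zero => rw [mul_zero']
  | add y z hy hz => rw [mul_add', hy, hz]
  | smul c a => simp [mul_smul', one_def, X_mul_X, form]

theorem mul_one' (x : QuantumTorus v Λ) : x * 1 = x := by
  induction x using induction_on with
  | zero => rw [zero_mul']
  | add y z hy hz => rw [add_mul', hy, hz]
  | smul c a => simp [smul_mul', one_def, X_mul_X, form]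

instance : Ring (QuantumTorus v Λ) where
  __ := (inferInstance : AddCommGroup (QuantumTorus v Λ))
  left_distrib := mul_add'
  right_distrib := add_mul'
  zero_mul := zero_mul'
  mul_zero := mul_zero'
  mul_assoc := mul_assoc'
  one_mul := one_mul'
  mul_one := mul_one'

instance : Algebra R (QuantumTorus v Λ) := Algebra.ofModule smul_mul' mul_smul'

end QuantumTorus

/-! ### The coefficient ring `ℤ[|k|^{±1/2}]` -/

/-- The ring `ℤ[|k|^{±1/2}]`, as a subring of `ℝ`. -/
def HalfRing (k : Type u) : Subring ℝ :=
  Subring.closure {Real.sqrt (Nat.card k), (Real.sqrt (Nat.card k))⁻¹}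

/-- The unit `|k|^{1/2}` of `ℤ[|k|^{±1/2}]`. -/
def sqrtCard (k : Type u) [Field k] [Finite k] : (HalfRing k)ˣ where
  val := ⟨Real.sqrt (Nat.card k), Subring.subset_closure (by simp)⟩
  inv := ⟨(Real.sqrt (Nat.card k))⁻¹, Subring.subset_closure (by simp)⟩
  val_inv := Subtype.ext (mul_inv_cancel₀ (Real.sqrt_pos.2 (Nat.cast_pos.2 Nat.card_pos)).ne')
  inv_val := Subtype.ext (inv_mul_cancel₀ (Real.sqrt_pos.2 (Nat.cast_pos.2 Nat.card_pos)).ne')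

/-! ### Ice quivers and the quantum Caldero–Chapoton elements -/

/-- The vertices of the principal part `Q` of an ice quiver `Q̃` with vertex set `V`, where `s` is
the set of non-frozen vertices. -/
def Principal {V : Type u} (s : Finset V) : Type u := {i : V // i ∈ s}

section IceQuiver

variable {V : Type u} [Quiver.{u} V] [DecidableEq V] [Fintype V] (s : Finset V)

instance : DecidableEq (Principal s) := inferInstanceAs (DecidableEq {i : V // i ∈ s})

instance : Fintype (Principal s) := inferInstanceAs (Fintype {i : V // i ∈ s})

/-- `Q` is the full subquiver of `Q̃` on the non-frozen vertices. -/
instance : Quiver.{u} (Principal s) := ⟨fun i j => i.1 ⟶ j.1⟩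

/-- `b_{ij} = #{arrows i ⟶ j} - #{arrows j ⟶ i}`, for `i` in `Q̃` and `j` in `Q`. -/
def BTilde : Matrix V (Principal s) ℤ :=
  Matrix.of fun i j => (Nat.card (i ⟶ j.1) : ℤ) - (Nat.card (j.1 ⟶ i) : ℤ)

/-- The left part `[I; 0]` of the identity matrix. -/
def ITilde : Matrix V (Principal s) ℤ := Matrix.of fun i j => if i = j.1 then 1 else 0

/-- `r_{ij} = dim_k Ext¹(S_i, S_j)` over `kQ̃`, for `i` in `Q̃` and `j` in `Q`. -/
def RTilde (k : Type u) [Field k] : Matrix V (Principal s) ℤ :=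
  Matrix.of fun i j => (extDim (simple k i) (simple k j.1) : ℤ)

/-- A quiver is acyclic if it has no oriented cycles of positive length. -/
def Acyclic (V : Type u) [Quiver.{u} V] : Prop :=
  ∀ (i : V) (p : Quiver.Path i i), p.length = 0

variable {s} {k : Type u} [Field k]

/-- The dimension vector of a `kQ`-module as an integer vector. -/
def dimZ (M : FDMod k (Principal s)) : Principal s → ℤ := fun i => (dimVec M.obj i : ℤ)

/-- The vector `(Ĩ - R̃) m`, where `m` is the dimension vector of the `kQ`-module `M`. -/
def IRdim (M : FDMod k (Principal s)) : V → ℤ := (ITilde s - RTilde s k) *ᵥ dimZ M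

/-- The quantum Caldero–Chapoton element of a `kQ`-module `M` with dimension vector `m`,
`X_M = ∑_e |Gr_e M| q^{-⟨e, m - e⟩/2} X^{B̃ e - (Ĩ - R̃) m}`.
The sum is over the vectors `0 ≤ e ≤ m`, since `Gr_e M` is empty for all others. -/
def CC [Finite k] (Λ : Matrix V V ℤ) (M : FDMod k (Principal s)) :
    QuantumTorus (sqrtCard k) Λ :=
  ∑ d ∈ Finset.Iic (dimVec M.obj),
    (((Gr M.obj d).ncard : HalfRing k) *
      ((sqrtCard k ^ (-eulerForm k (fun i => (d i : ℤ)) (dimZ M - fun i => (d i : ℤ))) :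
        (HalfRing k)ˣ) : HalfRing k)) •
    QuantumTorus.X (sqrtCard k) Λ (BTilde s *ᵥ (fun i => (d i : ℤ)) - IRdim M)

end IceQuiver

end

end QuantumCC

/-!
Both sides of the formula are sums over pairs `(U, W)` of a submodule `U` of `N` and a submodule
`W` of `M`, and they agree term by term.

The left-hand side is such a sum by definition. On the right-hand side, the sum over isomorphism
classes is a sum over `x ∈ Ext¹(M, N)` of the elements of the middle terms `E_x`
(`finsum_epsilon_smul`; every class comes from a short exact sequence, whose middle term is unique
up to isomorphism: `exists_shortExact_extClass_eq`, `nonempty_iso_of_extClass_eq`). A submodule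
`L` of `E_x` determines `U = L ∩ N` and the image `W` of `L` in `M`. The `L` over a given `(U, W)`
are the kernels of the maps `g⁻¹ W → N / U` restricting to the projection on `N`; these form a
torsor under `Hom(W, N / U)` if the image of `x` in `Ext¹(W, N / U)` vanishes, and there are none
otherwise (`card_submodule_over`, `card_extending`, `card_submodule_over_eq_ite`). The map
`Ext¹(M, N) → Ext¹(W, N / U)` is surjective since `kQ` is hereditary, so summing over `x` gives
`q ^ ([M, N]¹ + ⟨W, N / U⟩)` pairs `(x, L)` over `(U, W)` (`card_ker_mul_card_hom`). What remains
is an identity between exponents of `q^{1/2}` (`exponent_identity`), which follows from the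
compatibility of `Λ` with `B̃`.

The two inputs from representation theory are that finite modules have projective dimension at
most one and that `[M, N] - [M, N]¹` is the Euler form. Both hold for the simple modules `S_i`:
the kernel of `kQ → S_i` has as `k`-basis all paths except `e_i`, hence it is projective,
generated by the `e_j` with `j ≠ i` and the arrows into `i`, and morphisms out of it are known
(`simpleKerHomEquiv`). Over an acyclic quiver every nonzero finite module contains some `S_i`, and
the general case follows by induction along the long exact sequence (`isHereditaryEuler`). Since
`k` is finite, dimensions are handled as orders of finite groups, for which exact sequences give
multiplicativity.
-/

namespace QuantumCC

/-! ### Vertex spaces -/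

section Vertex

variable {k V : Type u} [Field k] [Quiver.{u} V] [DecidableEq V]

theorem PathAlgebra.e_mul_e (i : V) :
    PathAlgebra.e k i * PathAlgebra.e k i = PathAlgebra.e k i := by
  simp [PathAlgebra.e, PathAlgebra.ofPath_mul]

theorem PathAlgebra.e_mul_e_of_ne {i j : V} (h : i ≠ j) :
    PathAlgebra.e k i * PathAlgebra.e k j = 0 :=
  PathAlgebra.ofPath_mul_of_ne _ _ h

theorem PathAlgebra.e_mul_ofPath {i j : V} (p : Quiver.Path i j) :
    PathAlgebra.e k i * PathAlgebra.ofPath k p = PathAlgebra.ofPath k p := by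
  simp [PathAlgebra.e, PathAlgebra.ofPath_mul]

theorem PathAlgebra.ofPath_mul_e {i j : V} (p : Quiver.Path i j) :
    PathAlgebra.ofPath k p * PathAlgebra.e k j = PathAlgebra.ofPath k p := by
  simp [PathAlgebra.e, PathAlgebra.ofPath_mul]

variable [Fintype V]

/-- The vertex space `e_i M` of a module over the path algebra, encoded as the group of fixed
points of the idempotent `e_i`. -/
def vertexSpace (k : Type u) [Field k] (M : Type u) [AddCommGroup M]
    [Module (PathAlgebra k V) M] (i : V) : AddSubgroup M where
  carrier := {x | PathAlgebra.e k i • x = x}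
  add_mem' := fun hx hy => by
    simp only [Set.mem_ofPred_eq] at *
    rw [smul_add, hx, hy]
  zero_mem' := smul_zero _
  neg_mem' := fun hx => by
    simp only [Set.mem_ofPred_eq] at *
    rw [smul_neg, hx]

section

variable {M : Type u} [AddCommGroup M] [Module (PathAlgebra k V) M]

theorem mem_vertexSpace {i : V} {x : M} :
    x ∈ vertexSpace k M i ↔ PathAlgebra.e k i • x = x := Iff.rfl

theorem ofPath_smul_mem_vertexSpace {i j : V} (p : Quiver.Path i j) (x : M) :
    PathAlgebra.ofPath k p • x ∈ vertexSpace k M i := by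
  rw [mem_vertexSpace, smul_smul, PathAlgebra.e_mul_ofPath]

theorem e_smul_mem_vertexSpace (i : V) (x : M) :
    PathAlgebra.e k i • x ∈ vertexSpace k M i :=
  ofPath_smul_mem_vertexSpace _ x

theorem e_smul_of_mem_of_ne {i j : V} (h : j ≠ i) {x : M} (hx : x ∈ vertexSpace k M i) :
    PathAlgebra.e k j • x = 0 := by
  rw [← mem_vertexSpace.1 hx, smul_smul, PathAlgebra.e_mul_e_of_ne h, zero_smul]

theorem sum_e_smul (x : M) : ∑ i : V, PathAlgebra.e k i • x = x := by
  rw [← Finset.sum_smul, ← PathAlgebra.one_def, one_smul]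

end

/-- A module over the path algebra is the direct sum of its vertex spaces. -/
noncomputable def equivPiVertexSpace (M : Type u) [AddCommGroup M] [Module (PathAlgebra k V) M] :
    M ≃ ∀ i : V, vertexSpace k M i where
  toFun x i := ⟨PathAlgebra.e k i • x, e_smul_mem_vertexSpace i x⟩
  invFun f := ∑ i, (f i : M)
  left_inv := sum_e_smul
  right_inv f := by
    funext i
    apply Subtype.ext
    simp only [Finset.smul_sum]
    rw [Finset.sum_eq_single i]
    · exact (f i).2
    · intro j _ hj
      exact e_smul_of_mem_of_ne hj.symm (f j).2
    · simp

/-- The group `e_i M` has `|k| ^ d_i` elements, where `d` is the dimension vector of `M`. -/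
theorem card_vertexSpace (M : ModuleCat.{u} (PathAlgebra k V)) [Finite M] (i : V) :
    Nat.card (vertexSpace k M i) = Nat.card k ^ dimVec M i := by
  rw [dimVec, ← Module.natCard_eq_pow_finrank]
  refine Nat.card_congr (Equiv.setCongr ?_)
  ext x
  constructor
  · intro hx
    exact ⟨x, hx⟩
  · rintro ⟨y, rfl⟩
    exact e_smul_mem_vertexSpace i y

theorem card_eq_pow_sum_dimVec (M : ModuleCat.{u} (PathAlgebra k V)) [Finite M] :
    Nat.card M = Nat.card k ^ ∑ i, dimVec M i := by
  rw [Nat.card_congr (equivPiVertexSpace (k := k) (V := V) M), Nat.card_pi]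
  simp only [card_vertexSpace, Finset.prod_pow_eq_pow_sum]

theorem finite_of_finDim [Finite k] (M : FDMod k V) : Finite M.obj :=
  have : Module.Finite k M.obj := M.property
  Module.finite_of_finite k

theorem finDim_of_finite (M : ModuleCat.{u} (PathAlgebra k V)) [Finite M] : finDim k V M :=
  (inferInstance : Module.Finite k M)

theorem card_pow_injective [Finite k] {a b : ℕ} (h : Nat.card k ^ a = Nat.card k ^ b) : a = b :=
  Nat.pow_right_injective Finite.one_lt_card h

/-- Dimension vectors are additive on short exact sequences. -/
theorem dimVec_add [Finite k] {N E M : ModuleCat.{u} (PathAlgebra k V)} [Finite N] [Finite E]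
    [Finite M]
    (f : N →ₗ[PathAlgebra k V] E) (g : E →ₗ[PathAlgebra k V] M) (hf : Function.Injective f)
    (hg : Function.Surjective g) (hfg : Function.Exact f g) :
    dimVec E = dimVec N + dimVec M := by
  funext i
  refine card_pow_injective (k := k) ?_
  rw [Pi.add_apply, pow_add, ← card_vertexSpace, ← card_vertexSpace, ← card_vertexSpace]
  let φ : vertexSpace k E i →+ vertexSpace k M i :=
    { toFun x := ⟨g x, by rw [mem_vertexSpace, ← map_smul, mem_vertexSpace.1 x.2]⟩
      map_zero' := by simp
      map_add' := by simp }
  have hφ : Function.Surjective φ := by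
    rintro ⟨y, hy⟩
    obtain ⟨x, rfl⟩ := hg y
    refine ⟨⟨PathAlgebra.e k i • x, e_smul_mem_vertexSpace i x⟩, Subtype.ext ?_⟩
    exact (map_smul g _ _).trans hy
  rw [AddSubgroup.card_eq_card_quotient_mul_card_addSubgroup φ.ker,
    Nat.card_congr (QuotientAddGroup.quotientKerEquivOfSurjective φ hφ).toEquiv, mul_comm]
  congr 1
  refine (Nat.card_congr (Equiv.ofBijective
    (fun x : vertexSpace k N i => (⟨⟨f x, by
      rw [mem_vertexSpace, ← map_smul, mem_vertexSpace.1 x.2]⟩, by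
      rw [AddMonoidHom.mem_ker]
      exact Subtype.ext (hfg.apply_apply_eq_zero x)⟩ : φ.ker)) ⟨?_, ?_⟩)).symm
  · intro x y h
    exact Subtype.ext (hf (congrArg (fun z => z.1.1) h))
  · rintro ⟨⟨x, hx⟩, hx'⟩
    obtain ⟨y, rfl⟩ := (hfg x).1 (congrArg Subtype.val hx')
    refine ⟨⟨y, hf ?_⟩, rfl⟩
    rw [map_smul]
    exact hx

end Vertex

/-! ### The projective resolution of a simple module -/

section SimpleResolution

variable {k V : Type u} [Field k] [Quiver.{u} V] [DecidableEq V] [Fintype V]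

variable (k) in
/-- The projection of the regular module onto the simple module at the vertex `i`. -/
noncomputable def simpleProj (i : V) : PathAlgebra k V →ₗ[PathAlgebra k V] simple k i where
  toFun x := (simpleForm k i x : k)
  map_add' x y := map_add (simpleForm k i) x y
  map_smul' x y := simpleForm_mul i x y

theorem simpleProj_surjective (i : V) : Function.Surjective (simpleProj k i) := by
  intro c
  let c' : k := c
  refine ⟨c' • (1 : PathAlgebra k V), ?_⟩
  change simpleForm k i (c' • (1 : PathAlgebra k V)) = c'
  rw [map_smul, simpleForm_one, smul_eq_mul, mul_one]

variable (k) in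
/-- The kernel of the projection of the regular module onto the simple module at `i`: the span of
all paths other than `e_i`. -/
noncomputable abbrev simpleKer (i : V) : Submodule (PathAlgebra k V) (PathAlgebra k V) :=
  LinearMap.ker (simpleProj k i)

theorem mem_simpleKer {i : V} {x : PathAlgebra k V} :
    x ∈ simpleKer k i ↔ simpleForm k i x = 0 := Iff.rfl

/-- The free generators of `simpleKer k i`: the idempotents at the vertices other than `i`, and
the arrows `j ⟶ i`. -/
abbrev KerGen (i : V) : Type u := {j : V // j ≠ i} ⊕ (Σ j : V, (j ⟶ i))

/-- The vertex at which a free generator `g` starts, i.e. the vertex `j` with `e_j g = g`. -/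
def KerGen.source {i : V} : KerGen i → V
  | .inl j => j.1
  | .inr a => a.1

variable (k) in
/-- A free generator as an element of the path algebra. -/
noncomputable def KerGen.toPathAlgebra {i : V} : KerGen i → PathAlgebra k V
  | .inl j => PathAlgebra.e k j.1
  | .inr a => PathAlgebra.ofPath k a.2.toPath

theorem KerGen.toPathAlgebra_mem {i : V} (g : KerGen i) : g.toPathAlgebra k ∈ simpleKer k i := by
  rw [mem_simpleKer]
  rcases g with ⟨j, hj⟩ | ⟨j, a⟩
  · simp [toPathAlgebra, PathAlgebra.e, simpleForm_ofPath, hj]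
  · simp [toPathAlgebra, simpleForm_ofPath]

theorem KerGen.e_mul_toPathAlgebra {i : V} (g : KerGen i) :
    PathAlgebra.e k g.source * g.toPathAlgebra k = g.toPathAlgebra k := by
  rcases g with ⟨j, hj⟩ | ⟨j, a⟩
  · exact PathAlgebra.e_mul_e j
  · exact PathAlgebra.e_mul_ofPath _

section Extend

variable {N : Type u} [AddCommGroup N] [Module (PathAlgebra k V) N]

variable (k) in
/-- Every path other than `e_i` is uniquely of the form `p g` with `g` a free generator of
`simpleKer k i`; this is `p • f g`.  It is zero on `e_i`. -/
noncomputable def kerExtendPath {i : V} (f : KerGen i → N) {a : V} : ∀ {b : V}, Quiver.Path a b → N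
  | _, .nil => if h : a ≠ i then PathAlgebra.e k a • f (.inl ⟨a, h⟩) else 0
  | b, .cons p α => if h : b = i then PathAlgebra.ofPath k p • f (.inr ⟨_, h ▸ α⟩)
      else PathAlgebra.ofPath k (p.cons α) • f (.inl ⟨b, h⟩)

theorem kerExtendPath_of_ne {i : V} (f : KerGen i → N) {a b : V} (p : Quiver.Path a b)
    (h : b ≠ i) : kerExtendPath k f p = PathAlgebra.ofPath k p • f (.inl ⟨b, h⟩) := by
  cases p <;> simp [kerExtendPath, h, PathAlgebra.e]

theorem kerExtendPath_cons {i : V} (f : KerGen i → N) {a b : V} (p : Quiver.Path a b)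
    (α : b ⟶ i) :
    kerExtendPath k f (p.cons α) = PathAlgebra.ofPath k p • f (.inr ⟨b, α⟩) := by
  simp [kerExtendPath]

theorem kerExtendPath_nil {i : V} (f : KerGen i → N) :
    kerExtendPath k f (.nil : Quiver.Path i i) = 0 := by
  simp [kerExtendPath]

variable [Module k N] [IsScalarTower k (PathAlgebra k V) N]

/-- The `k`-linear extension of a function on the generators of `simpleKer k i`. -/
noncomputable def kerExtend {i : V} (f : KerGen i → N) : PathAlgebra k V →ₗ[k] N :=
  (PathAlgebra.basis k V).constr k fun p => kerExtendPath k f p.2.2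

theorem kerExtend_ofPath {i : V} (f : KerGen i → N) {a b : V} (p : Quiver.Path a b) :
    kerExtend f (PathAlgebra.ofPath k p) = kerExtendPath k f p := by
  simp [kerExtend, PathAlgebra.ofPath]

/-- The failure of `kerExtend f` to be linear over the path algebra is concentrated in the
coefficient of `e_i`. -/
theorem kerExtend_mul {i : V} (f : KerGen i → N)
    (hf : ∀ g : KerGen i, f g ∈ vertexSpace k N g.source) (x y : PathAlgebra k V) :
    kerExtend f (x * y) =
      x • kerExtend f y + simpleForm k i y • kerExtend f (x * PathAlgebra.e k i) := by
  induction y using PathAlgebra.induction_on with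
  | zero => simp
  | add y₁ y₂ h₁ h₂ => simp only [mul_add, map_add, h₁, h₂, smul_add, add_smul]; abel
  | smul d p =>
  rename_i a b
  induction x using PathAlgebra.induction_on with
  | zero => simp
  | add x₁ x₂ h₁ h₂ => simp only [add_mul, map_add, h₁, h₂, smul_add, add_smul]; abel
  | smul c q =>
  rename_i a' b'
  suffices H : kerExtend f (PathAlgebra.ofPath k q * PathAlgebra.ofPath k p) =
      PathAlgebra.ofPath k q • kerExtend f (PathAlgebra.ofPath k p) +
      simpleForm k i (PathAlgebra.ofPath k p) •
        kerExtend f (PathAlgebra.ofPath k q * PathAlgebra.e k i) by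
    simp only [smul_mul_assoc, mul_smul_comm, map_smul, H, smul_add, smul_eq_mul, smul_assoc]
    congr 1
    · rw [smul_algebra_smul_comm d (PathAlgebra.ofPath k q), smul_comm c d]
    · simp only [smul_smul]
      ring_nf
  have key : ∀ {l : V} (z : N), z ∈ vertexSpace k N l → b' ≠ l →
      PathAlgebra.ofPath k q • z = 0 := by
    intro l z hz hl
    rw [← mem_vertexSpace.1 hz, smul_smul, PathAlgebra.e, PathAlgebra.ofPath_mul_of_ne _ _ hl,
      zero_smul]
  by_cases hb : b = i
  · subst hb
    cases p with
    | nil =>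
      rw [kerExtend_ofPath, kerExtendPath_nil, smul_zero, zero_add, simpleForm_ofPath]
      simp [PathAlgebra.e]
    | cons p α =>
      rw [simpleForm_ofPath, if_neg (by simp), zero_smul, add_zero, kerExtend_ofPath,
        kerExtendPath_cons f p α, smul_smul]
      by_cases h : b' = a
      · subst h
        rw [PathAlgebra.ofPath_mul, PathAlgebra.ofPath_mul, Quiver.Path.comp_cons,
          kerExtend_ofPath, kerExtendPath_cons]
      · rw [PathAlgebra.ofPath_mul_of_ne _ _ h, PathAlgebra.ofPath_mul_of_ne _ _ h, map_zero,
          zero_smul]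
  · have h0 : simpleForm k i (PathAlgebra.ofPath k p) = 0 := by
      rw [simpleForm_ofPath, if_neg]
      rintro ⟨rfl, h⟩
      exact hb (Quiver.Path.eq_of_length_zero p h).symm
    rw [h0, zero_smul, add_zero, kerExtend_ofPath, kerExtendPath_of_ne f p hb, smul_smul]
    by_cases h : b' = a
    · subst h
      rw [PathAlgebra.ofPath_mul, kerExtend_ofPath, kerExtendPath_of_ne f _ hb]
    · rw [PathAlgebra.ofPath_mul_of_ne _ _ h, map_zero, zero_smul]

theorem kerExtend_gen {i : V} (f : KerGen i → N)
    (hf : ∀ g : KerGen i, f g ∈ vertexSpace k N g.source) (g : KerGen i) :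
    kerExtend f (g.toPathAlgebra k) = f g := by
  rcases g with ⟨j, hj⟩ | ⟨j, a⟩
  · rw [KerGen.toPathAlgebra, PathAlgebra.e, kerExtend_ofPath, kerExtendPath_of_ne f _ hj]
    exact hf (.inl ⟨j, hj⟩)
  · rw [KerGen.toPathAlgebra, kerExtend_ofPath]
    exact (kerExtendPath_cons f .nil a).trans (hf (.inr ⟨j, a⟩))

end Extend

variable {N : Type u} [AddCommGroup N] [Module (PathAlgebra k V) N]

/-- `simpleKer k i` is generated by its free generators. -/
theorem simpleKer_hom_ext {i : V} {φ ψ : simpleKer k i →ₗ[PathAlgebra k V] N}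
    (h : ∀ g : KerGen i, φ ⟨g.toPathAlgebra k, g.toPathAlgebra_mem⟩ =
      ψ ⟨g.toPathAlgebra k, g.toPathAlgebra_mem⟩) : φ = ψ := by
  -- An element of the path algebra lies in the kernel once its coefficient at `e_i` is removed,
  -- which makes induction over the whole path algebra possible.
  have key : ∀ x : PathAlgebra k V, ∃ (c : k) (hx : x - c • PathAlgebra.e k i ∈ simpleKer k i),
      φ ⟨_, hx⟩ = ψ ⟨_, hx⟩ := by
    intro x
    induction x using PathAlgebra.induction_on with
    | zero =>
      have e : (0 : PathAlgebra k V) - (0 : k) • PathAlgebra.e k i = 0 := by simp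
      have e' : (⟨(0 : PathAlgebra k V) - (0 : k) • PathAlgebra.e k i,
          by rw [e]; exact zero_mem _⟩ : simpleKer k i) = 0 := Subtype.ext e
      exact ⟨0, by rw [e]; exact zero_mem _, by rw [e', map_zero, map_zero]⟩
    | add y z hy hz =>
      obtain ⟨c, hc, h₁⟩ := hy
      obtain ⟨d, hd, h₂⟩ := hz
      have e : y + z - (c + d) • PathAlgebra.e k i =
          (y - c • PathAlgebra.e k i) + (z - d • PathAlgebra.e k i) := by rw [add_smul]; abel
      refine ⟨c + d, e ▸ add_mem hc hd, ?_⟩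
      have e' : (⟨_, e ▸ add_mem hc hd⟩ : simpleKer k i) = ⟨_, hc⟩ + ⟨_, hd⟩ := Subtype.ext e
      rw [e', map_add, map_add, h₁, h₂]
    | smul c p =>
      rename_i a b
      have gen : ∀ (y : PathAlgebra k V) (g : KerGen i),
          PathAlgebra.ofPath k p = y * g.toPathAlgebra k → ∃ c' : k,
          ∃ hx : c • PathAlgebra.ofPath k p - c' • PathAlgebra.e k i ∈ simpleKer k i,
          φ ⟨_, hx⟩ = ψ ⟨_, hx⟩ := by
        intro y g hy
        have e : c • PathAlgebra.ofPath k p - (0 : k) • PathAlgebra.e k i =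
            (c • y) • g.toPathAlgebra k := by
          rw [zero_smul, sub_zero, hy, smul_eq_mul, smul_mul_assoc]
        refine ⟨0, e ▸ Submodule.smul_mem _ _ g.toPathAlgebra_mem, ?_⟩
        have e' : (⟨_, e ▸ Submodule.smul_mem _ _ g.toPathAlgebra_mem⟩ : simpleKer k i) =
            (c • y) • ⟨_, g.toPathAlgebra_mem⟩ := Subtype.ext e
        rw [e', map_smul, map_smul, h]
      by_cases hb : b = i
      · subst hb
        cases p with
        | nil => 
          have e : c • PathAlgebra.ofPath k (.nil : Quiver.Path a a) - c • PathAlgebra.e k a = 0 :=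
            sub_self _
          have e' : (⟨_, e ▸ zero_mem _⟩ : simpleKer k a) = 0 := Subtype.ext e
          exact ⟨c, e ▸ zero_mem _, by rw [e', map_zero, map_zero]⟩
        | cons p α =>
          refine gen (PathAlgebra.ofPath k p) (.inr ⟨_, α⟩) ?_
          rw [KerGen.toPathAlgebra, PathAlgebra.ofPath_mul]
          rfl
      · exact gen (PathAlgebra.ofPath k p) (.inl ⟨b, hb⟩) (PathAlgebra.ofPath_mul_e p).symm
  ext ⟨x, hx⟩
  obtain ⟨c, hc, h'⟩ := key x
  have hc0 : c = 0 := by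
    have := mem_simpleKer.1 hc
    rw [map_sub, mem_simpleKer.1 hx, map_smul, PathAlgebra.e, simpleForm_ofPath] at this
    simpa using this
  subst hc0
  simpa using h'

/-- A morphism from `simpleKer k i` amounts to a choice of an element of `e_j N` for each
generator `g = e_j g`. -/
noncomputable def simpleKerHomEquiv (i : V) (N : Type u) [AddCommGroup N]
    [Module (PathAlgebra k V) N] : (simpleKer k i →ₗ[PathAlgebra k V] N) ≃
      ∀ g : KerGen i, vertexSpace k N g.source :=
  letI : Module k N := Module.restrictScalars k (PathAlgebra k V) N
  haveI : IsScalarTower k (PathAlgebra k V) N := IsScalarTower.restrictScalars k _ N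
  { toFun φ g := ⟨φ ⟨g.toPathAlgebra k, g.toPathAlgebra_mem⟩, by
      rw [mem_vertexSpace, ← map_smul]
      exact congrArg φ (Subtype.ext g.e_mul_toPathAlgebra)⟩
    invFun f :=
      { toFun x := kerExtend (k := k) (fun g => (f g : N)) x.1
        map_add' x y := map_add _ x.1 y.1
        map_smul' x y := by
          refine (kerExtend_mul (fun g => (f g : N)) (fun g => (f g).2) x y.1).trans ?_
          rw [mem_simpleKer.1 y.2, zero_smul, add_zero]
          rfl }
    left_inv φ := simpleKer_hom_ext fun g => kerExtend_gen
      (fun g : KerGen i => φ ⟨g.toPathAlgebra k, g.toPathAlgebra_mem⟩)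
      (fun g => by
        rw [mem_vertexSpace, ← map_smul]
        exact congrArg φ (Subtype.ext g.e_mul_toPathAlgebra)) g
    right_inv f := funext fun g => Subtype.ext
      (kerExtend_gen (fun g => (f g : N)) (fun g => (f g).2) g) }

theorem simpleKerHomEquiv_apply (i : V) (φ : simpleKer k i →ₗ[PathAlgebra k V] N) (g : KerGen i) :
    (simpleKerHomEquiv i N φ g : N) = φ ⟨g.toPathAlgebra k, g.toPathAlgebra_mem⟩ := rfl

instance (i : V) : Module.Projective (PathAlgebra k V) (simpleKer k i) := by
  refine Module.Projective.of_lifting_property fun f g hf => ?_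
  choose s hs using hf
  refine ⟨(simpleKerHomEquiv i _).symm fun x : KerGen i => ⟨PathAlgebra.e k x.source •
    s (simpleKerHomEquiv i _ g x), e_smul_mem_vertexSpace _ _⟩, simpleKer_hom_ext fun x => ?_⟩
  rw [LinearMap.comp_apply, ← simpleKerHomEquiv_apply, Equiv.apply_symm_apply, map_smul, hs]
  exact (simpleKerHomEquiv i _ g x).2

theorem card_simpleKer_hom [∀ i j : V, Finite (i ⟶ j)] (i : V) (N : ModuleCat.{u} (PathAlgebra k V))
    [Finite N] :
    Nat.card (simpleKer k i →ₗ[PathAlgebra k V] N) * Nat.card k ^ dimVec N i =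
      Nat.card k ^ (∑ j, dimVec N j + ∑ j, Nat.card (j ⟶ i) * dimVec N j) := by
  have := fun j : V => Fintype.ofFinite (j ⟶ i)
  rw [Nat.card_congr (simpleKerHomEquiv i N), Nat.card_pi, Fintype.prod_sum_type,
    Fintype.prod_sigma]
  simp only [KerGen.source, card_vertexSpace, Finset.prod_const, Finset.card_univ,
    Finset.prod_pow_eq_pow_sum, Nat.card_eq_fintype_card]
  simp only [← pow_mul, Finset.prod_pow_eq_pow_sum, ← pow_add]
  congr 1
  rw [Fintype.sum_eq_add_sum_subtype_ne (fun j => dimVec N j) i]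
  simp only [mul_comm]
  ring

end SimpleResolution

/-! ### Projective dimension and Euler form of finite modules -/

section Euler

/-- In an exact sequence `A → B → C`, the order of `B` is the product of the orders of the images
of the two maps. -/
theorem card_eq_card_range_mul_card_range {A B C : Type*} [AddCommGroup A] [AddCommGroup B]
    [AddCommGroup C] (f : A →+ B) (g : B →+ C) (h : ∀ b, g b = 0 ↔ ∃ a, f a = b) :
    Nat.card B = Nat.card f.range * Nat.card g.range := by
  have hfg : f.range = g.ker := by
    ext b
    rw [AddMonoidHom.mem_ker, h]
    rfl
  rw [AddSubgroup.card_eq_card_quotient_mul_card_addSubgroup g.ker,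
    Nat.card_congr (QuotientAddGroup.quotientKerEquivRange g).toEquiv, hfg, mul_comm]

variable {R : Type u} [Ring R]

theorem card_ext_zero (M N : ModuleCat.{u} R) : Nat.card (Ext.{u} M N 0) = Nat.card (M ⟶ N) :=
  Nat.card_congr Ext.homEquiv₀

/-- Multiplicativity of orders along the six-term exact sequence of `Hom` and `Ext¹`. -/
theorem card_ext_mul {S : ShortComplex (ModuleCat.{u} R)} (hS : S.ShortExact) (Y : ModuleCat.{u} R)
    (h2 : ∀ x : Ext.{u} S.X₃ Y 2, x = 0) :
    Nat.card (S.X₃ ⟶ Y) * Nat.card (S.X₁ ⟶ Y) * Nat.card (Ext.{u} S.X₂ Y 1) =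
      Nat.card (S.X₂ ⟶ Y) * Nat.card (Ext.{u} S.X₃ Y 1) * Nat.card (Ext.{u} S.X₁ Y 1) := by
  have := hS.epi_g
  let a : Ext.{u} S.X₃ Y 0 →+ Ext.{u} S.X₂ Y 0 := (Ext.mk₀ S.g).precomp Y (zero_add 0)
  let b : Ext.{u} S.X₂ Y 0 →+ Ext.{u} S.X₁ Y 0 := (Ext.mk₀ S.f).precomp Y (zero_add 0)
  let c : Ext.{u} S.X₁ Y 0 →+ Ext.{u} S.X₃ Y 1 := hS.extClass.precomp Y (add_zero 1)
  let d : Ext.{u} S.X₃ Y 1 →+ Ext.{u} S.X₂ Y 1 := (Ext.mk₀ S.g).precomp Y (zero_add 1)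
  let e : Ext.{u} S.X₂ Y 1 →+ Ext.{u} S.X₁ Y 1 := (Ext.mk₀ S.f).precomp Y (zero_add 1)
  have h₁ : Nat.card (Ext.{u} S.X₃ Y 0) = Nat.card a.range :=
    Nat.card_congr (AddMonoidHom.ofInjective (Ext.precomp_mk₀_injective_of_epi Y S.g)).toEquiv
  have h₂ := card_eq_card_range_mul_card_range a b fun x =>
    ⟨fun h => Ext.contravariant_sequence_exact₂ hS Y x h, by
      rintro ⟨y, rfl⟩
      simp [a, b]⟩
  have h₃ := card_eq_card_range_mul_card_range b c fun x =>
    ⟨fun h => Ext.contravariant_sequence_exact₁ hS Y x (add_zero 1) h, by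
      rintro ⟨y, rfl⟩
      simp [b, c]⟩
  have h₄ := card_eq_card_range_mul_card_range c d fun x =>
    ⟨fun h => Ext.contravariant_sequence_exact₃ hS Y x h (add_zero 1), by
      rintro ⟨y, rfl⟩
      simp [c, d]⟩
  have h₅ := card_eq_card_range_mul_card_range d e fun x =>
    ⟨fun h => Ext.contravariant_sequence_exact₂ hS Y x h, by
      rintro ⟨y, rfl⟩
      simp [d, e]⟩
  have h₆ : Nat.card e.range = Nat.card (Ext.{u} S.X₁ Y 1) := by
    have he : e.range = ⊤ := AddMonoidHom.range_eq_top.2 fun x =>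
      Ext.contravariant_sequence_exact₁ hS Y x rfl (h2 _)
    rw [he]
    exact AddSubgroup.card_top
  -- Each order is a product of orders of images of consecutive maps.
  rw [← card_ext_zero, ← card_ext_zero, ← card_ext_zero, h₁, h₂, h₃, h₄, h₅, ← h₆]
  ring

theorem finite_ext_middle {S : ShortComplex (ModuleCat.{u} R)} (hS : S.ShortExact)
    (Y : ModuleCat.{u} R) (h₁ : Finite (Ext.{u} S.X₁ Y 1)) (h₃ : Finite (Ext.{u} S.X₃ Y 1)) :
    Finite (Ext.{u} S.X₂ Y 1) := by
  let d : Ext.{u} S.X₃ Y 1 →+ Ext.{u} S.X₂ Y 1 := (Ext.mk₀ S.g).precomp Y (zero_add 1)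
  let e : Ext.{u} S.X₂ Y 1 →+ Ext.{u} S.X₁ Y 1 := (Ext.mk₀ S.f).precomp Y (zero_add 1)
  have h := card_eq_card_range_mul_card_range d e fun x =>
    ⟨fun h => Ext.contravariant_sequence_exact₂ hS Y x h, by
      rintro ⟨y, rfl⟩
      simp [d, e]⟩
  have : Finite d.range := Finite.of_surjective _ d.rangeRestrict_surjective
  have : Finite e.range := Finite.of_injective _ Subtype.val_injective
  refine Nat.finite_of_card_ne_zero ?_
  rw [h]
  exact mul_ne_zero Finite.card_pos.ne' Finite.card_pos.ne'

instance finite_hom (M N : ModuleCat.{u} R) [Finite M] [Finite N] : Finite (M ⟶ N) :=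
  Finite.of_injective (fun f : M ⟶ N => (fun x => f x : M → N)) fun f g h => by
    ext x
    exact congrFun h x

end Euler

section Simple

variable {k V : Type u} [Field k] [Quiver.{u} V] [DecidableEq V] [Fintype V]

theorem shortExact_simple (i : V) : (simpleProj k i).shortComplexKer.ShortExact :=
  LinearMap.shortExact_shortComplexKer (simpleProj_surjective i)

variable (k) in
/-- The statement that `M` has projective dimension at most one and that, for all finite `N`,
`[M, N] - [M, N]¹ = ∑ m_i n_i - ∑ #(j ⟶ i) m_i n_j`, in multiplicative form. -/
def IsHereditaryEuler (M : ModuleCat.{u} (PathAlgebra k V)) : Prop :=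
  HasProjectiveDimensionLT M 2 ∧ ∀ (N : ModuleCat.{u} (PathAlgebra k V)) [Finite N],
    Finite (Ext.{u} M N 1) ∧
    Nat.card (M ⟶ N) * Nat.card k ^ (∑ i, ∑ j, Nat.card (j ⟶ i) * dimVec M i * dimVec N j) =
      Nat.card (Ext.{u} M N 1) * Nat.card k ^ (∑ i, dimVec M i * dimVec N i)

/-- An element of the simple module `S_i`, as a scalar. -/
def simpleVal {i : V} (c : simple k i) : k := c

theorem simpleVal_smul {i : V} (a : PathAlgebra k V) (c : simple k i) :
    simpleVal (a • c) = simpleForm k i a * simpleVal c := rfl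

instance [Finite k] (i : V) : Finite (simple k i) := inferInstanceAs (Finite k)

theorem dimVec_simple [Finite k] (i j : V) : dimVec (simple k i) j = if j = i then 1 else 0 := by
  refine card_pow_injective (k := k) ?_
  rw [← card_vertexSpace]
  have h : ∀ c : simple k i, simpleVal (PathAlgebra.e k j • c) =
      (if j = i then 1 else 0 : k) * simpleVal c := by
    intro c
    simp [simpleVal_smul, PathAlgebra.e, simpleForm_ofPath]
  split_ifs with hij
  · rw [pow_one]
    refine Nat.card_congr (Equiv.subtypeUnivEquiv fun c => ?_)
    refine (h c).trans ?_
    rw [if_pos hij, one_mul]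
    rfl
  · rw [pow_zero, Nat.card_eq_one_iff_unique]
    refine ⟨⟨fun x y => Subtype.ext ?_⟩, ⟨0⟩⟩
    have h0 : ∀ x : vertexSpace k (simple k i) j, simpleVal x.1 = 0 := fun x => by
      rw [← mem_vertexSpace.1 x.2, h, if_neg hij, zero_mul]
    exact (h0 x).trans (h0 y).symm

variable [∀ i j : V, Finite (i ⟶ j)]

theorem isHereditaryEuler_simple [Finite k] (i : V) : IsHereditaryEuler k (simple k i) := by
  have hS := shortExact_simple (k := k) i
  have hP₂ : Projective (simpleProj k i).shortComplexKer.X₂ :=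
    (IsProjective.iff_projective _).1
      (inferInstanceAs (Module.Projective (PathAlgebra k V) (PathAlgebra k V)))
  have hP₁ : Projective (simpleProj k i).shortComplexKer.X₁ :=
    (IsProjective.iff_projective _).1
      (inferInstanceAs (Module.Projective (PathAlgebra k V) (simpleKer k i)))
  have hpd : HasProjectiveDimensionLT (simple k i) 2 :=
    (hS.hasProjectiveDimensionLT_X₃_iff 0 hP₂).2 inferInstance
  refine ⟨hpd, fun N _ => ?_⟩
  have hfin : Finite (simpleKer k i →ₗ[PathAlgebra k V] N) := by
    have := fun g : KerGen i => (inferInstance : Finite (vertexSpace k N g.source))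
    exact Finite.of_equiv _ (simpleKerHomEquiv i N).symm
  have key := card_ext_mul hS N fun x => x.eq_zero_of_hasProjectiveDimensionLT 2 le_rfl
  have e₁ : Nat.card (Ext.{u} (simpleProj k i).shortComplexKer.X₁ N 1) = 1 :=
    have := Ext.subsingleton_of_projective (simpleProj k i).shortComplexKer.X₁ N 0
    Nat.card_unique
  have e₂ : Nat.card (Ext.{u} (simpleProj k i).shortComplexKer.X₂ N 1) = 1 :=
    have := Ext.subsingleton_of_projective (simpleProj k i).shortComplexKer.X₂ N 0
    Nat.card_unique
  have e₃ : Nat.card ((simpleProj k i).shortComplexKer.X₁ ⟶ N) =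
      Nat.card (simpleKer k i →ₗ[PathAlgebra k V] N) := Nat.card_congr ModuleCat.homEquiv
  have e₄ : Nat.card ((simpleProj k i).shortComplexKer.X₂ ⟶ N) = Nat.card k ^ ∑ j, dimVec N j := by
    rw [← card_eq_pow_sum_dimVec]
    exact Nat.card_congr (ModuleCat.homEquiv.trans
      (LinearMap.ringLmapEquivSelf (PathAlgebra k V) ℕ N).toEquiv)
  rw [e₁, e₂, e₃, e₄, mul_one, mul_one] at key
  change Nat.card (simple k i ⟶ N) * _ = _ * Nat.card (Ext.{u} (simple k i) N 1) at key
  have hker := card_simpleKer_hom i N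
  refine ⟨?_, ?_⟩
  · refine Finite.of_surjective (fun f : simpleKer k i →ₗ[PathAlgebra k V] N =>
      hS.extClass.comp (Ext.mk₀ (ModuleCat.ofHom f)) (add_zero 1)) fun x => ?_
    obtain ⟨y, hy⟩ := precomp_extClass_surjective_of_projective_X₂ N hS 0 x
    obtain ⟨f, rfl⟩ := Ext.homEquiv₀.symm.surjective y
    exact ⟨f.hom, hy⟩
  · simp only [dimVec_simple, mul_ite, ite_mul, mul_one, one_mul, mul_zero, zero_mul,
      Finset.sum_ite_irrel, Finset.sum_const_zero, Finset.sum_ite_eq', Finset.mem_univ, if_true]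
    have hq : 0 < Nat.card k := Nat.card_pos
    refine Nat.eq_of_mul_eq_mul_left (pow_pos hq (∑ j, dimVec N j)) ?_
    calc _ = Nat.card (simple k i ⟶ N) *
          Nat.card k ^ (∑ j, dimVec N j + ∑ j, Nat.card (j ⟶ i) * dimVec N j) := by
          rw [pow_add]; ring
      _ = _ := by rw [← hker, ← mul_assoc, key, mul_assoc]

theorem IsHereditaryEuler.of_shortExact [Finite k]
    {S : ShortComplex (ModuleCat.{u} (PathAlgebra k V))}
    (hS : S.ShortExact) [Finite S.X₁] [Finite S.X₂] [Finite S.X₃]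
    (h₁ : IsHereditaryEuler k S.X₁) (h₃ : IsHereditaryEuler k S.X₃) : IsHereditaryEuler k S.X₂ := by
  refine ⟨hS.hasProjectiveDimensionLT_X₂ 2 h₁.1 h₃.1, fun N _ => ?_⟩
  obtain ⟨f₁, e₁⟩ := h₁.2 N
  obtain ⟨f₃, e₃⟩ := h₃.2 N
  refine ⟨finite_ext_middle hS N f₁ f₃, ?_⟩
  have := h₃.1
  have key := card_ext_mul hS N fun x => x.eq_zero_of_hasProjectiveDimensionLT 2 le_rfl
  have hdim := dimVec_add S.f.hom S.g.hom hS.injective_f hS.surjective_g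
    ((ShortComplex.ShortExact.moduleCat_exact_iff_function_exact S).1 hS.exact)
  rw [hdim]
  simp only [Pi.add_apply, mul_add, add_mul, Finset.sum_add_distrib, pow_add]
  have p₁ : 0 < Nat.card (Ext.{u} S.X₁ N 1) := Nat.card_pos
  have p₃ : 0 < Nat.card (Ext.{u} S.X₃ N 1) := Nat.card_pos
  refine Nat.eq_of_mul_eq_mul_left (mul_pos p₁ p₃) ?_
  generalize Nat.card k ^ (∑ i, ∑ j, Nat.card (j ⟶ i) * dimVec S.X₁ i * dimVec N j) = A₁ at *
  generalize Nat.card k ^ (∑ i, ∑ j, Nat.card (j ⟶ i) * dimVec S.X₃ i * dimVec N j) = A₃ at *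
  generalize Nat.card k ^ (∑ i, dimVec S.X₁ i * dimVec N i) = B₁ at *
  generalize Nat.card k ^ (∑ i, dimVec S.X₃ i * dimVec N i) = B₃ at *
  generalize Nat.card (Ext.{u} S.X₁ N 1) = x₁ at *
  generalize Nat.card (Ext.{u} S.X₃ N 1) = x₃ at *
  generalize Nat.card (Ext.{u} S.X₂ N 1) = x₂ at *
  calc _ = (Nat.card (S.X₂ ⟶ N) * x₃ * x₁) * (A₁ * A₃) := by ring
    _ = (Nat.card (S.X₁ ⟶ N) * A₁) * (Nat.card (S.X₃ ⟶ N) * A₃) * x₂ := by rw [← key]; ring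
    _ = _ := by rw [e₁, e₃]; ring

/-- Over an acyclic quiver, a nonzero module has a nonzero element `x` killed by all paths other
than `e_i`, for some vertex `i`. -/
theorem exists_simpleKer_smul_eq_zero (hV : Acyclic V) (M : ModuleCat.{u} (PathAlgebra k V))
    [Nontrivial M] :
    ∃ (i : V) (x : M), x ≠ 0 ∧ ∀ a : PathAlgebra k V, a • x = simpleForm k i a • x := by
  -- Take a vertex `i` with `e_i M ≠ 0` that is minimal for the reachability relation.
  let r : V → V → Prop := fun i j => ∃ p : Quiver.Path i j, p.length ≠ 0
  have : IsTrans V r := ⟨fun a b c ⟨p, hp⟩ ⟨q, _⟩ => ⟨p.comp q, by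
    rw [Quiver.Path.length_comp]; lia⟩⟩
  have : Std.Irrefl r := ⟨fun a ⟨p, hp⟩ => hp (hV a p)⟩
  have hwf : WellFounded r := Finite.wellFounded_of_trans_of_irrefl r
  have hne : {i : V | ∃ x ∈ vertexSpace k M i, x ≠ 0}.Nonempty := by
    obtain ⟨x, hx⟩ := exists_ne (0 : M)
    by_contra h
    refine hx ?_
    rw [← sum_e_smul (k := k) (V := V) x]
    refine Finset.sum_eq_zero fun i _ => ?_
    by_contra h'
    exact h ⟨i, _, e_smul_mem_vertexSpace i x, h'⟩
  obtain ⟨i, ⟨x, hx, hx0⟩, hmin⟩ := hwf.has_min _ hne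
  refine ⟨i, x, hx0, fun a => ?_⟩
  induction a using PathAlgebra.induction_on with
  | zero => simp
  | add y z hy hz => rw [add_smul, map_add, add_smul, hy, hz]
  | smul c p =>
    rename_i a b
    rw [map_smul, smul_assoc, smul_assoc]
    congr 1
    rw [simpleForm_ofPath]
    by_cases hb : b = i
    · subst hb
      by_cases hp : p.length = 0
      · obtain rfl := Quiver.Path.eq_of_length_zero p hp
        obtain rfl := Quiver.Path.eq_nil_of_length_zero p hp
        simpa using! mem_vertexSpace.1 hx
      · rw [if_neg (fun h => hp h.2), zero_smul]
        by_contra h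
        exact hmin a ⟨_, ofPath_smul_mem_vertexSpace p x, h⟩ ⟨p, hp⟩
    · rw [if_neg, zero_smul, ← mem_vertexSpace.1 hx, smul_smul, PathAlgebra.e,
        PathAlgebra.ofPath_mul_of_ne _ _ hb, zero_smul]
      rintro ⟨rfl, hp⟩
      exact hb (Quiver.Path.eq_of_length_zero p hp).symm

/-- Over an acyclic quiver, every finite module is an iterated extension of simple modules at
vertices, so it has projective dimension at most one and satisfies the Euler form identity. -/
theorem isHereditaryEuler [Finite k] (hV : Acyclic V) (M : ModuleCat.{u} (PathAlgebra k V))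
    [Finite M] : IsHereditaryEuler k M := by
  induction hn : Nat.card M using Nat.strong_induction_on generalizing M with
  | _ n ih =>
  rcases subsingleton_or_nontrivial M with hM | hM
  · have hz : Limits.IsZero M := ModuleCat.isZero_of_subsingleton M
    have hpd : HasProjectiveDimensionLT M 0 := hz.hasProjectiveDimensionLT_zero
    refine ⟨hasProjectiveDimensionLT_of_ge M 0 2 (by lia), fun N _ => ?_⟩
    have hs : Subsingleton (Ext.{u} M N 1) := HasProjectiveDimensionLT.subsingleton M 0 1 (by lia) N
    have h0 : dimVec M = 0 := by
      funext i
      refine card_pow_injective (k := k) ?_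
      rw [← card_vertexSpace]
      simp
    have : Unique (M ⟶ N) := (hz.unique_to N).some
    refine ⟨inferInstance, ?_⟩
    simp [h0]
  · obtain ⟨i, x, hx, hax⟩ := exists_simpleKer_smul_eq_zero hV M
    -- The span of `x` is a copy of `S_i`.
    let f : simple k i →ₗ[PathAlgebra k V] M :=
      { toFun c := simpleVal c • x
        map_add' c d := add_smul (simpleVal c) (simpleVal d) x
        map_smul' a c := by
          change (simpleForm k i a * simpleVal c) • x = a • simpleVal c • x
          rw [smul_algebra_smul_comm, hax, mul_smul, smul_comm] }
    have hf : Function.Injective f := by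
      rw [injective_iff_map_eq_zero]
      intro c hc
      exact (smul_eq_zero.1 (hc : simpleVal c • x = 0)).resolve_right hx
    let S : ShortComplex (ModuleCat.{u} (PathAlgebra k V)) :=
      ShortComplex.moduleCatMk f (LinearMap.range f).mkQ (by ext; simp)
    have hS : S.ShortExact :=
      { exact := (ShortComplex.ShortExact.moduleCat_exact_iff_function_exact S).2
          (LinearMap.exact_map_mkQ_range f)
        mono_f := (ModuleCat.mono_iff_injective _).2 hf
        epi_g := (ModuleCat.epi_iff_surjective _).2 (Submodule.mkQ_surjective _) }
    have : Finite S.X₁ := inferInstanceAs (Finite (simple k i))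
    have : Finite S.X₂ := inferInstanceAs (Finite M)
    have : Finite S.X₃ := Finite.of_surjective _ (Submodule.mkQ_surjective (LinearMap.range f))
    refine IsHereditaryEuler.of_shortExact hS (isHereditaryEuler_simple i) (ih _ ?_ S.X₃ rfl)
    have : Finite (M ⧸ LinearMap.range f) := this
    have hr : 1 < Nat.card (LinearMap.range f).toAddSubgroup :=
      have : Nontrivial (LinearMap.range f) := ⟨⟨⟨x, ⟨(1 : k), one_smul k x⟩⟩, 0,
        fun h => hx (congrArg Subtype.val h)⟩⟩
      Finite.one_lt_card (α := LinearMap.range f)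
    have hc := AddSubgroup.card_eq_card_quotient_mul_card_addSubgroup
      (LinearMap.range f).toAddSubgroup
    rw [← hn, hc]
    exact lt_mul_of_one_lt_right (Nat.card_pos (α := M ⧸ LinearMap.range f)) hr

end Simple

/-! ### The Euler form on dimension vectors -/

section EulerForm

variable {k V : Type u} [Field k] [Quiver.{u} V] [DecidableEq V] [Fintype V] [Finite k]

theorem card_hom (M N : ModuleCat.{u} (PathAlgebra k V)) [Finite M] [Finite N] :
    Nat.card (M ⟶ N) = Nat.card k ^ homDim M N :=
  Module.natCard_eq_pow_finrank

theorem card_ext (M N : ModuleCat.{u} (PathAlgebra k V)) [Finite (Ext.{u} M N 1)] :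
    Nat.card (Ext.{u} M N 1) = Nat.card k ^ extDim M N :=
  Module.natCard_eq_pow_finrank

theorem IsHereditaryEuler.homDim_add {M N : ModuleCat.{u} (PathAlgebra k V)} [Finite M] [Finite N]
    (h : IsHereditaryEuler k M) :
    homDim M N + ∑ i, ∑ j, Nat.card (j ⟶ i) * dimVec M i * dimVec N j =
      extDim M N + ∑ i, dimVec M i * dimVec N i := by
  obtain ⟨_, h⟩ := h.2 N
  rw [card_hom, card_ext, ← pow_add, ← pow_add] at h
  exact card_pow_injective h

theorem homDim_simple (i j : V) :
    homDim (simple k i) (simple k j) = if i = j then 1 else 0 := by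
  refine card_pow_injective (k := k) ?_
  rw [← card_hom]
  split_ifs with hij
  · subst hij
    rw [pow_one]
    rw [Nat.card_congr ModuleCat.homEquiv]
    let F : k → (simple k i →ₗ[PathAlgebra k V] simple k i) := fun c =>
      { toFun x := (simpleVal x * c : k)
        map_add' x y := add_mul (simpleVal x) (simpleVal y) c
        map_smul' a x := mul_assoc (simpleForm k i a) (simpleVal x) c }
    refine (Nat.card_congr (Equiv.ofBijective F ⟨fun c d h => ?_, fun f => ?_⟩)).symm
    · have : (1 * c : k) = 1 * d :=
        congrArg (fun f : simple k i →ₗ[PathAlgebra k V] simple k i => f (1 : k)) h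
      simpa using this
    · refine ⟨simpleVal (f (1 : k)), ?_⟩
      ext x
      have h1 : f ((simpleVal x • (1 : PathAlgebra k V)) • (show simple k i from (1 : k))) =
          (simpleVal x • (1 : PathAlgebra k V)) • f (1 : k) := map_smul f _ _
      have h2 : ∀ c : k, ∀ y : simple k i, simpleVal ((c • (1 : PathAlgebra k V)) • y) =
          c * simpleVal y := fun c y => by
        rw [simpleVal_smul, map_smul, simpleForm_one, smul_eq_mul, mul_one]
      have h3 : (simpleVal x • (1 : PathAlgebra k V)) • (show simple k i from (1 : k)) = x :=
        (h2 _ _).trans (mul_one (simpleVal x))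
      rw [h3] at h1
      exact ((congrArg simpleVal h1).trans (h2 _ _)).symm
  · rw [pow_zero, Nat.card_eq_one_iff_unique]
    refine ⟨⟨fun f g => ?_⟩, ⟨0⟩⟩
    have h0 : ∀ (f : simple k i ⟶ simple k j) (x : simple k i), simpleVal (f x) = 0 := by
      intro f x
      have hx : PathAlgebra.e k i • x = x := by
        change simpleForm k i (PathAlgebra.e k i) * simpleVal x = simpleVal x
        simp [PathAlgebra.e, simpleForm_ofPath]
      have hf : f (PathAlgebra.e k i • x) = PathAlgebra.e k i • f x := map_smul f.hom _ _
      rw [← hx, hf, simpleVal_smul]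
      simp [PathAlgebra.e, simpleForm_ofPath, hij]
    ext x
    exact (h0 f x).trans (h0 g x).symm

variable [∀ i j : V, Finite (i ⟶ j)]

theorem extDim_simple (i j : V) : extDim (simple k i) (simple k j) = Nat.card (j ⟶ i) := by
  have h := (isHereditaryEuler_simple (k := k) i).homDim_add (N := simple k j)
  rw [homDim_simple] at h
  simp only [dimVec_simple, mul_ite, mul_one, mul_zero, Finset.sum_ite_eq', Finset.mem_univ,
    if_true] at h
  lia

theorem eulerForm_eq (x y : V → ℤ) :
    eulerForm k x y = ∑ i, x i * y i - ∑ i, ∑ j, x i * y j * (Nat.card (j ⟶ i) : ℤ) := by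
  rw [eulerForm]
  simp only [homDim_simple, extDim_simple, mul_sub, Finset.sum_sub_distrib]
  congr 1
  simp

theorem eulerForm_dimVec (hV : Acyclic V) (M N : ModuleCat.{u} (PathAlgebra k V)) [Finite M]
    [Finite N] : eulerForm k (fun i => (dimVec M i : ℤ)) (fun i => (dimVec N i : ℤ)) =
      (homDim M N : ℤ) - extDim M N := by
  have h := congrArg (Nat.cast (R := ℤ)) ((isHereditaryEuler hV M).homDim_add (N := N))
  push_cast at h
  rw [eulerForm_eq, sub_eq_sub_iff_add_eq_add]
  rw [add_comm, ← h, add_comm, add_comm]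
  congr 1
  refine Finset.sum_congr rfl fun i _ => Finset.sum_congr rfl fun j _ => ?_
  ring

end EulerForm

/-! ### Extensions and their classes -/

section ExtensionClasses

variable {C : Type*} [Category* C] [Abelian C] [HasExt.{u} C]

/-- The morphisms on the middle term extending a given morphism `p` on the left term form a torsor
under the morphisms on the right term, nonempty exactly when `p` pushes the class out to zero. -/
theorem card_extending {S : ShortComplex C} (hS : S.ShortExact) {Y : C} (p : S.X₁ ⟶ Y)
    [Decidable (hS.extClass.comp (Ext.mk₀ p) (add_zero 1) = 0)] :
    Nat.card {r : S.X₂ ⟶ Y // S.f ≫ r = p} =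
      if hS.extClass.comp (Ext.mk₀ p) (add_zero 1) = 0 then Nat.card (S.X₃ ⟶ Y) else 0 := by
  split_ifs with h
  · obtain ⟨x, hx⟩ := Ext.contravariant_sequence_exact₁ hS Y (Ext.mk₀ p) (add_zero 1) h
    obtain ⟨r₀, rfl⟩ := Ext.homEquiv₀.symm.surjective x
    have hr₀ : S.f ≫ r₀ = p := by
      apply Ext.homEquiv₀.symm.injective
      exact (Ext.mk₀_comp_mk₀ S.f r₀).symm.trans hx
    have := hS.epi_g
    refine (Nat.card_congr (Equiv.ofBijective
      (fun t : S.X₃ ⟶ Y => (⟨r₀ + S.g ≫ t, by simp [hr₀]⟩ : {r : S.X₂ ⟶ Y // S.f ≫ r = p}))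
      ⟨fun t t' h => ?_, fun ⟨r, hr⟩ => ?_⟩)).symm
    · have h' := add_left_cancel (congrArg Subtype.val h)
      exact (cancel_epi S.g).1 h'
    · refine ⟨hS.exact.desc (r - r₀) (by simp [hr, hr₀]), Subtype.ext ?_⟩
      simp
  · have : IsEmpty {r : S.X₂ ⟶ Y // S.f ≫ r = p} := by
      refine ⟨fun ⟨r, hr⟩ => h ?_⟩
      rw [← hr, ← Ext.mk₀_comp_mk₀, hS.extClass_comp_assoc]
    exact Nat.card_of_isEmpty

/-- Short exact sequences with the same class have isomorphic middle terms. -/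
theorem nonempty_iso_of_extClass_eq {N M E E' : C} {f : N ⟶ E} {g : E ⟶ M} {w : f ≫ g = 0}
    {f' : N ⟶ E'} {g' : E' ⟶ M} {w' : f' ≫ g' = 0} (hS : (ShortComplex.mk f g w).ShortExact)
    (hS' : (ShortComplex.mk f' g' w').ShortExact) (h : hS.extClass = hS'.extClass) :
    Nonempty (E ≅ E') := by
  -- `f'` extends to `E` because it pushes the common class out to zero.
  obtain ⟨x, hx⟩ := Ext.contravariant_sequence_exact₁ hS E' (Ext.mk₀ f') (add_zero 1)
    (h ▸ hS'.extClass_comp)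
  obtain ⟨φ, rfl⟩ := Ext.homEquiv₀.symm.surjective x
  have hφ : f ≫ φ = f' := by
    apply Ext.homEquiv₀.symm.injective
    exact (Ext.mk₀_comp_mk₀ f φ).symm.trans hx
  have := hS.epi_g
  -- The induced endomorphism `ψ` of `M` fixes the class, so `ψ - 1` lifts along `g'`.
  let ψ : M ⟶ M := hS.exact.desc (φ ≫ g') (by
    change f ≫ φ ≫ g' = 0
    rw [← Category.assoc, hφ, w'])
  have hψ : g ≫ ψ = φ ≫ g' := hS.exact.g_desc _ _
  have hnat := ShortComplex.ShortExact.extClass_naturality hS hS'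
    { τ₁ := 𝟙 N, τ₂ := φ, τ₃ := ψ, comm₁₂ := by simp [hφ], comm₂₃ := by simp [hψ] }
  obtain ⟨y, hy⟩ := Ext.covariant_sequence_exact₃ M hS' (Ext.mk₀ (ψ - 𝟙 M)) (zero_add 1) (by
    dsimp at hnat
    rw [Ext.comp_mk₀_id, h] at hnat
    have hsub : Ext.mk₀ (ψ - 𝟙 M) = Ext.mk₀ ψ - Ext.mk₀ (𝟙 M) :=
      map_sub (Ext.addEquiv₀ (X := M) (Y := M)).symm ψ (𝟙 M)
    rw [hsub, sub_eq_add_neg, Ext.add_comp, Ext.neg_comp, ← hnat, Ext.mk₀_id_comp,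
      add_neg_cancel])
  obtain ⟨t, rfl⟩ := Ext.homEquiv₀.symm.surjective y
  have ht : t ≫ g' = ψ - 𝟙 M := by
    apply Ext.homEquiv₀.symm.injective
    exact (Ext.mk₀_comp_mk₀ t g').symm.trans hy
  let Φ : ShortComplex.mk f g w ⟶ ShortComplex.mk f' g' w' :=
    { τ₁ := 𝟙 N
      τ₂ := φ - g ≫ t
      τ₃ := 𝟙 M
      comm₁₂ := by simp [hφ, reassoc_of% w]
      comm₂₃ := by simp [ht, hψ] }
  have : IsIso Φ.τ₁ := inferInstanceAs (IsIso (𝟙 N))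
  have : IsIso Φ.τ₃ := inferInstanceAs (IsIso (𝟙 M))
  have : IsIso Φ.τ₂ := ShortComplex.isIso₂_of_shortExact_of_isIso₁₃ Φ hS hS'
  exact ⟨asIso Φ.τ₂⟩

variable {R : Type u} [Ring R]

theorem shortExact_moduleCatMk {X₁ X₂ X₃ : Type u} [AddCommGroup X₁] [AddCommGroup X₂]
    [AddCommGroup X₃] [Module R X₁] [Module R X₂] [Module R X₃] (f : X₁ →ₗ[R] X₂) (g : X₂ →ₗ[R] X₃)
    (hf : Function.Injective f) (hg : Function.Surjective g) (hfg : Function.Exact f g) :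
    (ShortComplex.moduleCatMk f g hfg.linearMap_comp_eq_zero).ShortExact where
  exact := (ShortComplex.ShortExact.moduleCat_exact_iff_function_exact _).2 hfg
  mono_f := (ModuleCat.mono_iff_injective _).2 hf
  epi_g := (ModuleCat.epi_iff_surjective _).2 hg

/-- The pushout of a short exact sequence along a morphism on its left term: its class is the
composition of the class with the morphism. -/
theorem exists_shortExact_extClass_eq_comp {S : ShortComplex (ModuleCat.{u} R)} (hS : S.ShortExact)
    {N : ModuleCat.{u} R} (φ : S.X₁ ⟶ N) :
    ∃ (E : ModuleCat.{u} R) (f : N ⟶ E) (g : E ⟶ S.X₃) (w : f ≫ g = 0)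
      (h : (ShortComplex.mk f g w).ShortExact),
      h.extClass = hS.extClass.comp (Ext.mk₀ φ) (add_zero 1) := by
  let i : S.X₁ →ₗ[R] S.X₂ := S.f.hom
  let π : S.X₂ →ₗ[R] S.X₃ := S.g.hom
  let ψ : S.X₁ →ₗ[R] N := φ.hom
  have hi : Function.Injective i := hS.moduleCat_injective_f
  have hπ : Function.Surjective π := hS.moduleCat_surjective_g
  have hiπ : Function.Exact i π :=
    (ShortComplex.ShortExact.moduleCat_exact_iff_function_exact S).1 hS.exact
  -- The pushout is the quotient of `S.X₂ × N` by the antidiagonal copy of `S.X₁`.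
  let Q : Submodule R (S.X₂ × N) := LinearMap.range (i.prod (-ψ))
  have hQ : ∀ l, (i l, -ψ l) ∈ Q := fun l => ⟨l, rfl⟩
  let f : N →ₗ[R] (S.X₂ × N) ⧸ Q := Q.mkQ ∘ₗ LinearMap.inr R _ _
  let g : ((S.X₂ × N) ⧸ Q) →ₗ[R] S.X₃ := Q.liftQ (π ∘ₗ LinearMap.fst R _ _) (by
    rintro _ ⟨z, rfl⟩
    exact hiπ.apply_apply_eq_zero z)
  have hf : Function.Injective f := by
    rw [injective_iff_map_eq_zero]
    intro n hn
    obtain ⟨z, hz⟩ := (Submodule.Quotient.mk_eq_zero Q).1 hn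
    have hz₁ : i z = 0 := congrArg Prod.fst hz
    have hz₂ : -ψ z = n := congrArg Prod.snd hz
    rw [← hz₂, hi (hz₁.trans (map_zero i).symm), map_zero, neg_zero]
  have hg : Function.Surjective g := by
    intro m
    obtain ⟨p, rfl⟩ := hπ m
    exact ⟨Q.mkQ (p, 0), rfl⟩
  have hfg : Function.Exact f g := by
    intro z
    constructor
    · intro hz
      obtain ⟨⟨p, n⟩, rfl⟩ := Q.mkQ_surjective z
      obtain ⟨l, rfl⟩ := (hiπ p).1 hz
      refine ⟨n + ψ l, (Submodule.Quotient.eq Q).2 ?_⟩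
      convert hQ (-l) using 1
      simp
    · rintro ⟨n, rfl⟩
      exact map_zero π
  have hS' := shortExact_moduleCatMk f g hf hg hfg
  refine ⟨_, ModuleCat.ofHom f, ModuleCat.ofHom g, _, hS', ?_⟩
  have hnat := ShortComplex.ShortExact.extClass_naturality hS hS'
    { τ₁ := φ, τ₂ := ModuleCat.ofHom (Q.mkQ ∘ₗ LinearMap.inl R _ _), τ₃ := 𝟙 S.X₃
      comm₁₂ := by
        ext l
        refine (Submodule.Quotient.eq Q).2 ?_
        convert hQ (-l) using 1
        exact Prod.ext ((zero_sub _).trans (map_neg i l).symm)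
          ((sub_zero (ψ l)).trans (by rw [map_neg, neg_neg] : ψ l = -ψ (-l)))
      comm₂₃ := by
        ext l
        rfl }
  exact ((Ext.mk₀_id_comp _).symm.trans hnat.symm)

/-- Every element of `Ext¹(M, N)` is the class of a short exact sequence: a pushout of a projective
presentation of `M`. -/
theorem exists_shortExact_extClass_eq (M N : ModuleCat.{u} R) (x : Ext.{u} M N 1) :
    ∃ (E : ModuleCat.{u} R) (f : N ⟶ E) (g : E ⟶ M) (w : f ≫ g = 0)
      (h : (ShortComplex.mk f g w).ShortExact), h.extClass = x := by
  have hS := M.shortExact_projectiveShortComplex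
  obtain ⟨y, rfl⟩ := precomp_extClass_surjective_of_projective_X₂ N hS 0 x
  obtain ⟨φ, rfl⟩ := Ext.homEquiv₀.symm.surjective y
  exact exists_shortExact_extClass_eq_comp hS φ

end ExtensionClasses

/-! ### Submodules of the middle term of an extension -/

section CountSubmodules

variable {R : Type u} [Ring R]

section

variable {N E M : Type u} [AddCommGroup N] [AddCommGroup E] [AddCommGroup M] [Module R N]
  [Module R E] [Module R M] (f : N →ₗ[R] E) (g : E →ₗ[R] M)

/-- The inclusion of the left term of a short exact sequence into the preimage of a submodule of
the right term. -/
def toComap (hfg : Function.Exact f g) (W : Submodule R M) : N →ₗ[R] W.comap g :=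
  f.codRestrict _ fun n => by
    rw [Submodule.mem_comap, hfg.apply_apply_eq_zero]
    exact W.zero_mem

variable {f g}

/-- Let `0 → N → E → M → 0` be exact, `U ≤ N` and `W ≤ M`. The submodules of `E` with preimage `U`
in `N` and image `W` in `M` are the kernels of the linear maps `g⁻¹ W → N / U` restricting to the
projection on `N`. -/
theorem card_submodule_over (hg : Function.Surjective g)
    (hfg : Function.Exact f g) (U : Submodule R N) (W : Submodule R M) :
    Nat.card {L : Submodule R E // L.comap f = U ∧ L.map g = W} =
      Nat.card {r : W.comap g →ₗ[R] N ⧸ U // r ∘ₗ toComap f g hfg W = U.mkQ} := by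
  -- The kernel of `r`, as a submodule of `E`.
  let F : {r : W.comap g →ₗ[R] N ⧸ U // r ∘ₗ toComap f g hfg W = U.mkQ} → Submodule R E :=
    fun r => (LinearMap.ker r.1).map (W.comap g).subtype
  have hF : ∀ r x, x ∈ F r ↔ ∃ hx : x ∈ W.comap g, r.1 ⟨x, hx⟩ = 0 := by
    intro r x
    simp [F]
  have hr : ∀ (r : {r : W.comap g →ₗ[R] N ⧸ U // r ∘ₗ toComap f g hfg W = U.mkQ}) (n : N),
      r.1 (toComap f g hfg W n) = U.mkQ n := fun r n => LinearMap.congr_fun r.2 n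
  -- Subtracting from `x` an element of `N` with the same value of `r` gives an element of `F r`.
  have hsub : ∀ r (x : W.comap g), ∃ n : N, r.1 x = U.mkQ n ∧ (x : E) - f n ∈ F r := by
    intro r x
    obtain ⟨n, hn⟩ := U.mkQ_surjective (r.1 x)
    refine ⟨n, hn.symm, (hF r _).2 ⟨(x - toComap f g hfg W n).2, ?_⟩⟩
    change r.1 (x - toComap f g hfg W n) = 0
    rw [map_sub, hr, hn, sub_self]
  have hU : ∀ r, (F r).comap f = U := by
    intro r
    ext n
    rw [Submodule.mem_comap, hF]
    constructor
    · rintro ⟨_, hn⟩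
      exact (Submodule.Quotient.mk_eq_zero U).1 ((hr r n).symm.trans hn)
    · intro hn
      exact ⟨(toComap f g hfg W n).2, (hr r n).trans ((Submodule.Quotient.mk_eq_zero U).2 hn)⟩
  have hW : ∀ r, (F r).map g = W := by
    intro r
    apply le_antisymm
    · rintro _ ⟨x, hx, rfl⟩
      exact ((hF r x).1 hx).1
    · intro w hw
      obtain ⟨x, rfl⟩ := hg w
      obtain ⟨n, -, hn⟩ := hsub r ⟨x, hw⟩
      refine ⟨_, hn, ?_⟩
      rw [map_sub, hfg.apply_apply_eq_zero, sub_zero]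
  refine (Nat.card_congr (Equiv.ofBijective
    (fun r => (⟨F r, hU r, hW r⟩ : {L : Submodule R E // L.comap f = U ∧ L.map g = W}))
    ⟨fun r r' h => ?_, ?_⟩)).symm
  · have h' : F r = F r' := congrArg Subtype.val h
    refine Subtype.ext (LinearMap.ext fun x => ?_)
    obtain ⟨n, hn, hx⟩ := hsub r x
    rw [h'] at hx
    obtain ⟨hx', h0⟩ := (hF r' _).1 hx
    have h1 : r'.1 (x - toComap f g hfg W n) = 0 := h0
    rw [map_sub, hr, sub_eq_zero] at h1
    rw [hn, h1]
  · rintro ⟨L, hU, hW⟩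
    let L' : Submodule R (W.comap g) := L.comap (W.comap g).subtype
    have hL' : ∀ n, toComap f g hfg W n ∈ L' ↔ n ∈ U := by
      intro n
      rw [← hU]
      exact Iff.rfl
    -- As `g⁻¹ W = L + N`, the map `N / U → g⁻¹ W / L` is an isomorphism; its inverse gives `r`.
    let ψ : (N ⧸ U) →ₗ[R] (W.comap g) ⧸ L' :=
      U.mapQ L' (toComap f g hfg W) fun n hn => (hL' n).2 hn
    have hψ : Function.Bijective ψ := by
      constructor
      · rw [injective_iff_map_eq_zero]
        intro z hz
        obtain ⟨n, rfl⟩ := U.mkQ_surjective z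
        exact (Submodule.Quotient.mk_eq_zero U).2
          ((hL' n).1 ((Submodule.Quotient.mk_eq_zero L').1 hz))
      · intro z
        obtain ⟨⟨x, hx⟩, rfl⟩ := L'.mkQ_surjective z
        obtain ⟨l, hl, hlx⟩ : g x ∈ L.map g := by rw [hW]; exact hx
        obtain ⟨n, hn⟩ := (hfg (x - l)).1 (by rw [map_sub, hlx, sub_self])
        refine ⟨U.mkQ n, (Submodule.Quotient.eq L').2 ?_⟩
        change f n - x ∈ L
        rw [hn, sub_sub_cancel_left]
        exact L.neg_mem hl
    let e := LinearEquiv.ofBijective ψ hψ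
    refine ⟨⟨e.symm.toLinearMap ∘ₗ L'.mkQ, LinearMap.ext fun n => e.symm_apply_eq.2 rfl⟩,
      Subtype.ext (Submodule.ext fun x => ?_)⟩
    rw [hF]
    constructor
    · rintro ⟨hx, h0⟩
      exact (Submodule.Quotient.mk_eq_zero L').1 (e.symm.map_eq_zero_iff.1 h0)
    · intro hx
      have hxW : x ∈ W.comap g := by
        rw [Submodule.mem_comap, ← hW]
        exact ⟨x, hx, rfl⟩
      exact ⟨hxW, e.symm.map_eq_zero_iff.2 ((Submodule.Quotient.mk_eq_zero L').2 hx)⟩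

end

/-- The class in `Ext¹(W, N / U)` obtained from a class in `Ext¹(M, N)` by pulling back to a
submodule `W` of `M` and pushing out to a quotient of `N`. -/
noncomputable def subquotientExt {M N : ModuleCat.{u} R} (U : Submodule R N) (W : Submodule R M) :
    Ext.{u} M N 1 →+ Ext.{u} (ModuleCat.of R W) (ModuleCat.of R (N ⧸ U)) 1 :=
  ((Ext.mk₀ (ModuleCat.ofHom U.mkQ)).postcomp (ModuleCat.of R W) (add_zero 1)).comp
    ((Ext.mk₀ (ModuleCat.ofHom W.subtype)).precomp N (zero_add 1))

open scoped Classical in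
/-- The number of submodules of the middle term over a pair `(U, W)`. -/
theorem card_submodule_over_eq_ite {N E M : ModuleCat.{u} R} {f : N ⟶ E} {g : E ⟶ M} {w : f ≫ g = 0}
    (hS : (ShortComplex.mk f g w).ShortExact) (U : Submodule R N) (W : Submodule R M) :
    Nat.card {L : Submodule R E // L.comap f.hom = U ∧ L.map g.hom = W} =
      if subquotientExt U W hS.extClass = 0 then
        Nat.card (ModuleCat.of R W ⟶ ModuleCat.of R (N ⧸ U)) else 0 := by
  have hf : Function.Injective f.hom := hS.moduleCat_injective_f
  have hg : Function.Surjective g.hom := hS.moduleCat_surjective_g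
  have hfg : Function.Exact f.hom g.hom :=
    (ShortComplex.ShortExact.moduleCat_exact_iff_function_exact _).1 hS.exact
  let gW : W.comap g.hom →ₗ[R] W := g.hom.restrict fun x hx => hx
  have hSW := shortExact_moduleCatMk (toComap f.hom g.hom hfg W) gW
    (fun x y h => hf (congrArg Subtype.val h))
    (fun y => by
      obtain ⟨x, hx⟩ := hg y.1
      exact ⟨⟨x, by rw [Submodule.mem_comap, hx]; exact y.2⟩, Subtype.ext hx⟩)
    (fun x => by
      constructor
      · intro hx
        obtain ⟨n, hn⟩ := (hfg x.1).1 (congrArg Subtype.val hx)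
        exact ⟨n, Subtype.ext hn⟩
      · rintro ⟨n, rfl⟩
        exact Subtype.ext (hfg.apply_apply_eq_zero n))
  have hnat := ShortComplex.ShortExact.extClass_naturality hSW hS
    { τ₁ := 𝟙 N, τ₂ := ModuleCat.ofHom (W.comap g.hom).subtype, τ₃ := ModuleCat.ofHom W.subtype
      comm₁₂ := by ext; rfl
      comm₂₃ := by ext; rfl }
  have hcls : hSW.extClass =
      (Ext.mk₀ (ModuleCat.ofHom W.subtype)).comp hS.extClass (zero_add 1) :=
    (Ext.comp_mk₀_id _).symm.trans hnat
  have key := card_extending hSW (ModuleCat.ofHom U.mkQ)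
  rw [hcls] at key
  rw [card_submodule_over hg hfg]
  refine Eq.trans (Nat.card_congr ?_) key
  refine (ModuleCat.homEquiv (R := R) (M := ModuleCat.of R (W.comap g.hom))
    (N := ModuleCat.of R (N ⧸ U))).symm.subtypeEquiv fun r => ?_
  constructor
  · intro h
    exact ModuleCat.hom_ext h
  · intro h
    exact congrArg ModuleCat.Hom.hom h

/-- `Ext¹` is right exact in both arguments when the relevant `Ext²` vanish. -/
theorem subquotientExt_surjective {M N : ModuleCat.{u} R} (U : Submodule R N) (W : Submodule R M)
    (hW : HasProjectiveDimensionLT (ModuleCat.of R W) 2)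
    (hM : HasProjectiveDimensionLT (ModuleCat.of R (M ⧸ W)) 2) :
    Function.Surjective (subquotientExt (M := M) U W) := by
  intro x
  have hU := shortExact_moduleCatMk U.subtype U.mkQ U.subtype_injective U.mkQ_surjective
    (LinearMap.exact_subtype_mkQ U)
  have hWM := shortExact_moduleCatMk W.subtype W.mkQ W.subtype_injective W.mkQ_surjective
    (LinearMap.exact_subtype_mkQ W)
  obtain ⟨y, hy⟩ := Ext.covariant_sequence_exact₃ _ hU x rfl
    (Ext.eq_zero_of_hasProjectiveDimensionLT _ 2 le_rfl)
  have := hM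
  obtain ⟨z, hz⟩ := Ext.contravariant_sequence_exact₁ hWM N y rfl
    (Ext.eq_zero_of_hasProjectiveDimensionLT (X := ModuleCat.of R (M ⧸ W)) _ 2 le_rfl)
  refine ⟨z, ?_⟩
  rw [← hy, ← hz]
  rfl

end CountSubmodules

/-! ### Counting over all extensions -/

section CountExtensions

variable {k V : Type u} [Field k] [Quiver.{u} V] [DecidableEq V] [Fintype V] [Finite k]

/-- A submodule of the middle term is an extension of its image by its preimage. -/
theorem dimVec_of_comap_of_map {N E M : ModuleCat.{u} (PathAlgebra k V)} [Finite N] [Finite E]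
    [Finite M] (f : N →ₗ[PathAlgebra k V] E) (g : E →ₗ[PathAlgebra k V] M)
    (hf : Function.Injective f) (hfg : Function.Exact f g) {U : Submodule (PathAlgebra k V) N}
    {W : Submodule (PathAlgebra k V) M} {L : Submodule (PathAlgebra k V) E} (hU : L.comap f = U)
    (hW : L.map g = W) :
    dimVec (ModuleCat.of (PathAlgebra k V) L) =
      dimVec (ModuleCat.of (PathAlgebra k V) U) + dimVec (ModuleCat.of (PathAlgebra k V) W) := by
  subst hU hW
  refine dimVec_add (f.restrict (p := L.comap f) (q := L) fun x hx => hx)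
    (g.restrict (p := L) (q := L.map g) fun x hx => ⟨x, hx, rfl⟩) ?_ ?_ ?_
  · exact fun x y h => Subtype.ext (hf (congrArg Subtype.val h))
  · rintro ⟨_, x, hx, rfl⟩
    exact ⟨⟨x, hx⟩, rfl⟩
  · rintro ⟨x, hx⟩
    constructor
    · intro h
      obtain ⟨n, rfl⟩ := (hfg x).1 (congrArg Subtype.val h)
      exact ⟨⟨n, hx⟩, rfl⟩
    · rintro ⟨n, hn⟩
      rw [← hn]
      exact Subtype.ext (hfg.apply_apply_eq_zero n.1)

theorem dimVec_submodule_add_quotient {N : ModuleCat.{u} (PathAlgebra k V)} [Finite N]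
    (U : Submodule (PathAlgebra k V) N) :
    dimVec N = dimVec (ModuleCat.of (PathAlgebra k V) U) +
      dimVec (ModuleCat.of (PathAlgebra k V) (N ⧸ U)) :=
  have : Finite (N ⧸ U) := Finite.of_surjective _ U.mkQ_surjective
  dimVec_add (N := ModuleCat.of (PathAlgebra k V) U) (M := ModuleCat.of (PathAlgebra k V) (N ⧸ U))
    U.subtype U.mkQ U.subtype_injective U.mkQ_surjective (LinearMap.exact_subtype_mkQ U)

/-- Summing a function of the dimension vector over all submodules of all extensions of `M` by `N`
amounts to summing over pairs of submodules of `N` and of `M`. -/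
theorem sum_ext_sum_submodule {T : Type*} [AddCommMonoid T] {M N : ModuleCat.{u} (PathAlgebra k V)}
    [Finite M] [Finite N] [Fintype (Ext.{u} M N 1)]
    {E : Ext.{u} M N 1 → ModuleCat.{u} (PathAlgebra k V)}
    [∀ x, Finite (E x)] {f : ∀ x, N ⟶ E x} {g : ∀ x, E x ⟶ M} {w : ∀ x, f x ≫ g x = 0}
    (hS : ∀ x, (ShortComplex.mk (f x) (g x) (w x)).ShortExact) (hx : ∀ x, (hS x).extClass = x)
    [∀ x, Fintype (Submodule (PathAlgebra k V) (E x))] [Fintype (Submodule (PathAlgebra k V) M)]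
    [Fintype (Submodule (PathAlgebra k V) N)] (φ : (V → ℕ) → T) :
    ∑ x, ∑ L : Submodule (PathAlgebra k V) (E x), φ (dimVec (ModuleCat.of (PathAlgebra k V) L)) =
      ∑ U : Submodule (PathAlgebra k V) N, ∑ W : Submodule (PathAlgebra k V) M,
        (Nat.card (subquotientExt (M := M) U W).ker *
          Nat.card (ModuleCat.of (PathAlgebra k V) W ⟶ ModuleCat.of (PathAlgebra k V) (N ⧸ U))) •
        φ (dimVec (ModuleCat.of (PathAlgebra k V) U) +
          dimVec (ModuleCat.of (PathAlgebra k V) W)) := by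
  classical
  have h₁ : ∀ x, ∑ L : Submodule (PathAlgebra k V) (E x),
      φ (dimVec (ModuleCat.of (PathAlgebra k V) L)) =
      ∑ p : Submodule (PathAlgebra k V) N × Submodule (PathAlgebra k V) M,
        (if subquotientExt p.1 p.2 x = 0 then Nat.card (ModuleCat.of (PathAlgebra k V) p.2 ⟶
          ModuleCat.of (PathAlgebra k V) (N ⧸ p.1)) else 0) •
        φ (dimVec (ModuleCat.of (PathAlgebra k V) p.1) +
          dimVec (ModuleCat.of (PathAlgebra k V) p.2)) := by
    intro x
    rw [← Finset.sum_fiberwise (g := fun L : Submodule (PathAlgebra k V) (E x) =>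
      (L.comap (f x).hom, L.map (g x).hom))]
    refine Finset.sum_congr rfl fun p _ => ?_
    have hcard := card_submodule_over_eq_ite (hS x) p.1 p.2
    rw [hx] at hcard
    rw [← hcard, Finset.sum_congr rfl
      (g := fun _ => φ (dimVec (ModuleCat.of (PathAlgebra k V) p.1) +
        dimVec (ModuleCat.of (PathAlgebra k V) p.2))), Finset.sum_const, Nat.card_eq_fintype_card,
      Fintype.card_subtype]
    · congr 2
      ext L
      simp [Prod.ext_iff]
    · intro L hL
      have hL' := Prod.ext_iff.1 (Finset.mem_filter.1 hL).2
      rw [dimVec_of_comap_of_map (f x).hom (g x).hom (hS x).moduleCat_injective_f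
        ((ShortComplex.ShortExact.moduleCat_exact_iff_function_exact _).1 (hS x).exact) hL'.1 hL'.2]
  rw [Finset.sum_congr rfl fun x _ => h₁ x, Finset.sum_comm, Fintype.sum_prod_type]
  refine Finset.sum_congr rfl fun U _ => Finset.sum_congr rfl fun W _ => ?_
  rw [← Finset.sum_smul]
  congr 1
  rw [← Finset.sum_filter, Finset.sum_const, smul_eq_mul]
  congr 1
  exact (Nat.subtype_card _ fun x => by simp [AddMonoidHom.mem_ker]).symm

variable [∀ i j : V, Finite (i ⟶ j)]

/-- The number of pairs of an extension of `M` by `N` and a submodule of it over `(U, W)` is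
`q ^ ([M, N]¹ + ⟨W, N / U⟩)`. The surjectivity of `Ext¹(M, N) → Ext¹(W, N / U)` enters here. -/
theorem card_ker_mul_card_hom (hV : Acyclic V) {M N : ModuleCat.{u} (PathAlgebra k V)}
    [Finite M] [Finite N] (U : Submodule (PathAlgebra k V) N) (W : Submodule (PathAlgebra k V) M) :
    ∃ a : ℕ, Nat.card (subquotientExt (M := M) U W).ker *
        Nat.card (ModuleCat.of (PathAlgebra k V) W ⟶ ModuleCat.of (PathAlgebra k V) (N ⧸ U)) =
        Nat.card k ^ a ∧
      (a : ℤ) = extDim M N + eulerForm k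
        (fun i => (dimVec (ModuleCat.of (PathAlgebra k V) W) i : ℤ))
        ((fun i => (dimVec N i : ℤ)) -
          fun i => (dimVec (ModuleCat.of (PathAlgebra k V) U) i : ℤ)) := by
  have : Finite (N ⧸ U) := Finite.of_surjective _ U.mkQ_surjective
  have : Finite (M ⧸ W) := Finite.of_surjective _ W.mkQ_surjective
  have : Finite (ModuleCat.of (PathAlgebra k V) (N ⧸ U)) := ‹Finite (N ⧸ U)›
  have : Finite (ModuleCat.of (PathAlgebra k V) (M ⧸ W)) := ‹Finite (M ⧸ W)›
  have : Finite (ModuleCat.of (PathAlgebra k V) W) := inferInstanceAs (Finite W)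
  have hW := isHereditaryEuler hV (ModuleCat.of (PathAlgebra k V) W)
  have hMW := isHereditaryEuler hV (ModuleCat.of (PathAlgebra k V) (M ⧸ W))
  have := ((isHereditaryEuler hV M).2 N).1
  have := (hW.2 (ModuleCat.of (PathAlgebra k V) (N ⧸ U))).1
  have hsurj := subquotientExt_surjective (M := M) U W hW.1 hMW.1
  have h₁ := AddSubgroup.card_eq_card_quotient_mul_card_addSubgroup
    (subquotientExt (M := M) U W).ker
  rw [Nat.card_congr (QuotientAddGroup.quotientKerEquivOfSurjective _ hsurj).toEquiv, card_ext,
    card_ext] at h₁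
  have hq : 1 < Nat.card k := Finite.one_lt_card
  have hle : extDim (ModuleCat.of (PathAlgebra k V) W) (ModuleCat.of (PathAlgebra k V) (N ⧸ U)) ≤
      extDim M N := (Nat.pow_dvd_pow_iff_le_right hq).1 ⟨_, h₁⟩
  obtain ⟨c, hc⟩ := Nat.exists_eq_add_of_le hle
  rw [hc, pow_add] at h₁
  have h₂ := Nat.eq_of_mul_eq_mul_left (pow_pos Nat.card_pos _) h₁
  refine ⟨_, by rw [← h₂, card_hom, ← pow_add], ?_⟩
  have hdim : ((fun i => (dimVec N i : ℤ)) -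
      fun i => (dimVec (ModuleCat.of (PathAlgebra k V) U) i : ℤ)) =
      fun i => (dimVec (ModuleCat.of (PathAlgebra k V) (N ⧸ U)) i : ℤ) := by
    funext i
    have := congrFun (dimVec_submodule_add_quotient U) i
    rw [Pi.add_apply] at this
    rw [Pi.sub_apply, this]
    push_cast
    ring
  rw [hdim, eulerForm_dimVec hV, hc]
  push_cast
  ring

end CountExtensions

section MiddleTerms

variable {k V : Type u} [Field k] [Quiver.{u} V] [DecidableEq V] [Fintype V] [Finite k]

/-- Every class in `Ext¹(M, N)` is realized with the chosen representative of an isomorphism class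
as middle term. -/
theorem exists_isoClass_extClass_eq (M N : FDMod k V) (x : Ext.{u} M.obj N.obj 1) :
    ∃ (c : IsoClass k V) (f : N.obj ⟶ c.out.obj) (g : c.out.obj ⟶ M.obj) (w : f ≫ g = 0)
      (h : (ShortComplex.mk f g w).ShortExact), h.extClass = x := by
  obtain ⟨E, f, g, w, h, hx⟩ := exists_shortExact_extClass_eq M.obj N.obj x
  have := finite_of_finDim M
  have := finite_of_finDim N
  have hE : Finite E := by
    refine Nat.finite_of_card_ne_zero ?_
    rw [card_eq_card_range_mul_card_range f.hom.toAddMonoidHom g.hom.toAddMonoidHom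
      ((ShortComplex.ShortExact.moduleCat_exact_iff_function_exact _).1 h.exact)]
    have : Finite f.hom.toAddMonoidHom.range :=
      Finite.of_surjective _ f.hom.toAddMonoidHom.rangeRestrict_surjective
    have : Finite g.hom.toAddMonoidHom.range := Finite.of_injective _ Subtype.val_injective
    exact mul_ne_zero Finite.card_pos.ne' Finite.card_pos.ne'
  let E' : FDMod k V := ⟨E, finDim_of_finite E⟩
  let c : IsoClass k V := Quotient.mk _ E'
  have hc : IsIsomorphic c.out E' := Quotient.exact (Quotient.out_eq c)
  obtain ⟨e'⟩ := hc
  let e : E ≅ c.out.obj := ((finDim k V).ι.mapIso e').symm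
  have w' : (f ≫ e.hom) ≫ (e.inv ≫ g) = 0 := by simp [w]
  let φ : ShortComplex.mk f g w ≅ ShortComplex.mk (f ≫ e.hom) (e.inv ≫ g) w' :=
    ShortComplex.isoMk (Iso.refl _) e (Iso.refl _) (by simp) (by simp)
  have h' := ShortComplex.shortExact_of_iso φ h
  refine ⟨c, f ≫ e.hom, e.inv ≫ g, w', h', ?_⟩
  have hnat := ShortComplex.ShortExact.extClass_naturality h h' φ.hom
  rw [← hx]
  exact (Ext.mk₀_id_comp _).symm.trans (hnat.symm.trans (Ext.comp_mk₀_id _))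

/-- The sets `Ext¹(M, N)_E` are disjoint for distinct isomorphism classes of `E`: the middle term is
determined by the class. -/
theorem mem_extWithMiddle_iff {M N : FDMod k V} {x : Ext.{u} M.obj N.obj 1} {c : IsoClass k V}
    {f : N.obj ⟶ c.out.obj} {g : c.out.obj ⟶ M.obj} {w : f ≫ g = 0}
    (h : (ShortComplex.mk f g w).ShortExact) (hx : h.extClass = x) (d : IsoClass k V) :
    x ∈ extWithMiddle M.obj N.obj d.out.obj ↔ c = d := by
  constructor
  · rintro ⟨E, f', g', w', h', ⟨e⟩, hx'⟩
    obtain ⟨e'⟩ := nonempty_iso_of_extClass_eq h h' (hx.trans hx'.symm)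
    rw [← Quotient.out_equiv_out]
    exact ⟨(finDim k V).fullyFaithfulι.preimageIso (e' ≪≫ e)⟩
  · rintro rfl
    exact ⟨_, f, g, w, h, ⟨Iso.refl _⟩, hx⟩

theorem finsum_ncard_fiber_smul {ι κ T : Type*} [Fintype ι] [AddCommMonoid T] (m : ι → κ)
    (F : κ → T) : ∑ᶠ c, Set.ncard {x | m x = c} • F c = ∑ x, F (m x) := by
  classical
  rw [Finset.sum_comp, finsum_eq_sum_of_support_subset (s := Finset.univ.image m)]
  · refine Finset.sum_congr rfl fun c _ => ?_
    rw [← Set.ncard_coe_finset]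
    simp
  · intro c hc
    by_contra h
    refine hc ?_
    have : {x | m x = c} = ∅ := by
      ext x
      simp only [Finset.coe_image, Finset.coe_univ, Set.image_univ, Set.mem_range, not_exists] at h
      simpa using h x
    simp [this]

/-- The sum over isomorphism classes in the multiplication formula, as a sum over `Ext¹(M, N)`. -/
theorem finsum_epsilon_smul {T : Type*} [AddCommMonoid T] {M N : FDMod k V}
    [Fintype (Ext.{u} M.obj N.obj 1)] {c : Ext.{u} M.obj N.obj 1 → IsoClass k V}
    {f : ∀ x, N.obj ⟶ (c x).out.obj} {g : ∀ x, (c x).out.obj ⟶ M.obj} {w : ∀ x, f x ≫ g x = 0}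
    (h : ∀ x, (ShortComplex.mk (f x) (g x) (w x)).ShortExact) (hx : ∀ x, (h x).extClass = x)
    (F : FDMod k V → T) :
    ∑ᶠ E : IsoClass k V, epsilon M.obj N.obj E.out.obj • F E.out = ∑ x, F (c x).out := by
  rw [← finsum_ncard_fiber_smul c fun E => F E.out]
  refine finsum_congr fun E => ?_
  have hE : extWithMiddle M.obj N.obj E.out.obj = {x | c x = E} :=
    Set.ext fun x => mem_extWithMiddle_iff (h x) (hx x) E
  rw [epsilon, hE]

end MiddleTerms

/-! ### Exponents and the multiplication formula -/

section Exponents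

variable {V : Type u} [Quiver.{u} V] [DecidableEq V] [Fintype V] {s : Finset V}

instance [∀ i j : V, Finite (i ⟶ j)] (i j : Principal s) : Finite (i ⟶ j) :=
  inferInstanceAs (Finite (i.1 ⟶ j.1))

theorem Acyclic.principal (hV : Acyclic V) : Acyclic (Principal s) := by
  let F : Principal s ⥤q V := { obj := fun i => i.1, map := fun a => a }
  have hF : ∀ {i j : Principal s} (p : Quiver.Path i j), (F.mapPath p).length = p.length := by
    intro i j p
    induction p with
    | nil => rfl
    | cons p a ih => rw [Prefunctor.mapPath_cons, Quiver.Path.length_cons, ih]; rfl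
  intro i p
  rw [← hF]
  exact hV _ _

variable {Λ : Matrix V V ℤ}

/-- Since `Λ B̃ = -Ĩ`, pairing with `B̃ y` only sees the non-frozen coordinates. -/
theorem form_BTilde (hΛ : Λ * (-BTilde s) = ITilde s) (a : V → ℤ) (y : Principal s → ℤ) :
    form Λ a (BTilde s *ᵥ y) = -∑ j, a j.1 * y j := by
  have h : Λ * BTilde s = -ITilde s := by rw [← hΛ, Matrix.mul_neg, neg_neg]
  rw [form, Matrix.mulVec_mulVec, h, Matrix.neg_mulVec, dotProduct_neg]
  congr 1
  simp only [dotProduct, Matrix.mulVec, ITilde, Matrix.of_apply, ite_mul, one_mul, zero_mul,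
    Finset.mul_sum, mul_ite, mul_zero]
  rw [Finset.sum_comm]
  simp

theorem form_sub_left (a b c : V → ℤ) : form Λ (a - b) c = form Λ a c - form Λ b c :=
  sub_dotProduct _ _ _

theorem form_sub_right (a b c : V → ℤ) : form Λ a (b - c) = form Λ a b - form Λ a c := by
  rw [form, Matrix.mulVec_sub, dotProduct_sub]
  rfl

theorem form_swap (hskew : Λᵀ = -Λ) (a b : V → ℤ) : form Λ a b = -form Λ b a := by
  rw [form, Matrix.dotProduct_mulVec, ← Matrix.mulVec_transpose, hskew, Matrix.neg_mulVec,
    neg_dotProduct, dotProduct_comm]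
  rfl

variable {k : Type u} [Field k] [Finite k] [∀ i j : V, Finite (i ⟶ j)]

theorem form_BTilde_BTilde (hΛ : Λ * (-BTilde s) = ITilde s) (x y : Principal s → ℤ) :
    form Λ (BTilde s *ᵥ x) (BTilde s *ᵥ y) = eulerForm k x y - eulerForm k y x := by
  rw [form_BTilde hΛ, eulerForm_eq, eulerForm_eq]
  simp only [Matrix.mulVec, dotProduct, BTilde, Matrix.of_apply, Finset.sum_mul, sub_mul,
    Finset.sum_sub_distrib]
  have h₁ : ∑ i, x i * y i = ∑ i, y i * x i := Finset.sum_congr rfl fun i _ => mul_comm _ _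
  have h₂ : ∑ j : Principal s, ∑ i : Principal s, (Nat.card (j.1 ⟶ i.1) : ℤ) * x i * y j =
      ∑ i, ∑ j, x i * y j * (Nat.card (j ⟶ i) : ℤ) := by
    rw [Finset.sum_comm]
    refine Finset.sum_congr rfl fun i _ => Finset.sum_congr rfl fun j _ => ?_
    change _ = x i * y j * (Nat.card (j.1 ⟶ i.1) : ℤ)
    ring
  have h₃ : ∑ j : Principal s, ∑ i : Principal s, (Nat.card (i.1 ⟶ j.1) : ℤ) * x i * y j =
      ∑ i, ∑ j, y i * x j * (Nat.card (j ⟶ i) : ℤ) := by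
    refine Finset.sum_congr rfl fun i _ => Finset.sum_congr rfl fun j _ => ?_
    change _ = y i * x j * (Nat.card (j.1 ⟶ i.1) : ℤ)
    ring
  rw [h₁, h₂, h₃]
  ring

theorem form_IR_BTilde (hΛ : Λ * (-BTilde s) = ITilde s) (z x : Principal s → ℤ) :
    form Λ ((ITilde s - RTilde s k) *ᵥ z) (BTilde s *ᵥ x) = -eulerForm k x z := by
  rw [form_BTilde hΛ, eulerForm_eq, neg_inj]
  simp only [Matrix.sub_mulVec, Pi.sub_apply, sub_mul, Finset.sum_sub_distrib]
  congr 1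
  · refine Finset.sum_congr rfl fun j _ => ?_
    rw [mul_comm]
    congr 1
    simp only [Matrix.mulVec, dotProduct, ITilde, Matrix.of_apply, ite_mul, one_mul, zero_mul]
    rw [Finset.sum_eq_single j]
    · simp
    · intro l _ hl
      exact if_neg fun h => hl (Subtype.ext h.symm)
    · simp
  · refine Finset.sum_congr rfl fun j _ => ?_
    simp only [Matrix.mulVec, dotProduct, RTilde, Matrix.of_apply, extDim_simple, Finset.sum_mul]
    refine Finset.sum_congr rfl fun l _ => ?_
    change _ = x j * z l * (Nat.card (l.1 ⟶ j.1) : ℤ)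
    ring

theorem eulerForm_add_left (x x' y : Principal s → ℤ) :
    eulerForm k (x + x') y = eulerForm k x y + eulerForm k x' y := by
  simp only [eulerForm, Pi.add_apply, add_mul, Finset.sum_add_distrib]

theorem eulerForm_sub_right (x y y' : Principal s → ℤ) :
    eulerForm k x (y - y') = eulerForm k x y - eulerForm k x y' := by
  simp only [eulerForm, Pi.sub_apply, mul_sub, sub_mul, Finset.sum_sub_distrib]
  ring

theorem eulerForm_add_right (x y y' : Principal s → ℤ) :
    eulerForm k x (y + y') = eulerForm k x y + eulerForm k x y' := by
  simp only [eulerForm, Pi.add_apply, mul_add, add_mul, Finset.sum_add_distrib]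

/-- The identity of exponents of `q^{1/2}` behind the multiplication formula. -/
theorem exponent_identity (hskew : Λᵀ = -Λ) (hΛ : Λ * (-BTilde s) = ITilde s)
    (m n w u : Principal s → ℤ) :
    form Λ (BTilde s *ᵥ u - (ITilde s - RTilde s k) *ᵥ n)
        (BTilde s *ᵥ w - (ITilde s - RTilde s k) *ᵥ m) -
      eulerForm k u (n - u) - eulerForm k w (m - w) =
    -form Λ ((ITilde s - RTilde s k) *ᵥ m) ((ITilde s - RTilde s k) *ᵥ n) +
      2 * eulerForm k w (n - u) - eulerForm k (u + w) (n + m - (u + w)) := by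
  rw [form_sub_left, form_sub_right, form_sub_right, form_BTilde_BTilde (k := k) hΛ,
    form_IR_BTilde hΛ, form_swap hskew (BTilde s *ᵥ u), form_IR_BTilde hΛ,
    form_swap hskew (_ *ᵥ n) (_ *ᵥ m)]
  simp only [eulerForm_add_left, eulerForm_add_right, eulerForm_sub_right]
  ring

end Exponents

section Multiplication

variable {V : Type u} [Quiver.{u} V] [DecidableEq V] [Fintype V] {s : Finset V}
  {k : Type u} [Field k] [Finite k] {Λ : Matrix V V ℤ}

/-- The quantum Caldero–Chapoton element as a sum over all submodules. -/
theorem CC_eq_sum (M : FDMod k (Principal s))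
    [Fintype (Submodule (PathAlgebra k (Principal s)) M.obj)] :
    CC Λ M = ∑ U : Submodule (PathAlgebra k (Principal s)) M.obj,
      ((sqrtCard k ^ (-eulerForm k
        (fun i => (dimVec (ModuleCat.of (PathAlgebra k (Principal s)) U) i : ℤ))
        (dimZ M - fun i => (dimVec (ModuleCat.of (PathAlgebra k (Principal s)) U) i : ℤ))) :
        (HalfRing k)ˣ) : HalfRing k) •
      QuantumTorus.X (sqrtCard k) Λ (BTilde s *ᵥ
        (fun i => (dimVec (ModuleCat.of (PathAlgebra k (Principal s)) U) i : ℤ)) - IRdim M) := by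
  classical
  have := finite_of_finDim M
  -- Dimension vectors of submodules are bounded by that of `M`, so the sum over `d` loses nothing.
  have hmaps : ∀ U ∈ (Finset.univ : Finset (Submodule (PathAlgebra k (Principal s)) M.obj)),
      dimVec (ModuleCat.of (PathAlgebra k (Principal s)) U) ∈ Finset.Iic (dimVec M.obj) := by
    intro U _
    rw [Finset.mem_Iic, dimVec_submodule_add_quotient U]
    exact le_self_add
  rw [CC, ← Finset.sum_fiberwise_of_maps_to hmaps]
  refine Finset.sum_congr rfl fun d _ => ?_
  rw [Finset.sum_congr rfl (g := fun _ =>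
    ((sqrtCard k ^ (-eulerForm k (fun i => (d i : ℤ)) (dimZ M - fun i => (d i : ℤ))) :
      (HalfRing k)ˣ) : HalfRing k) •
    QuantumTorus.X (sqrtCard k) Λ (BTilde s *ᵥ (fun i => (d i : ℤ)) - IRdim M)),
    Finset.sum_const, mul_smul, Nat.cast_smul_eq_nsmul, ← Set.ncard_coe_finset]
  · congr 2
    ext U
    simp [Gr]
  · intro U hU
    rw [← (Finset.mem_filter.1 hU).2]

theorem card_eq_sqrtCard_sq :
    (Nat.card k : HalfRing k) = ((sqrtCard k ^ 2 : (HalfRing k)ˣ) : HalfRing k) := by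
  apply Subtype.ext
  simp [sqrtCard]

theorem card_pow_eq_sqrtCard_zpow (a : ℕ) :
    (Nat.card k : HalfRing k) ^ a = ((sqrtCard k ^ (2 * a : ℤ) : (HalfRing k)ˣ) : HalfRing k) := by
  rw [card_eq_sqrtCard_sq, ← Units.val_pow_eq_pow_val, ← pow_mul]
  norm_cast

/-- The multiplication formula. Both sides become sums over pairs of submodules of `N` and `M`,
which agree term by term. -/
theorem card_pow_extDim_smul_CC_mul_CC [∀ i j : V, Finite (i ⟶ j)] (hV : Acyclic V)
    (hskew : Λᵀ = -Λ)
    (hΛ : Λ * (-BTilde s) = ITilde s)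
    (M N : FDMod k (Principal s)) :
    (Nat.card k : HalfRing k) ^ extDim M.obj N.obj •
        (CC Λ N * CC Λ M) =
      ((sqrtCard k ^ (-form Λ (IRdim M) (IRdim N)) :
          (HalfRing k)ˣ) : HalfRing k) •
        ∑ᶠ E : IsoClass k (Principal s),
          epsilon M.obj N.obj E.out.obj • CC Λ E.out := by
  classical
  have := finite_of_finDim M
  have := finite_of_finDim N
  have hQ : Acyclic (Principal s) := hV.principal
  have := ((isHereditaryEuler hQ M.obj).2 N.obj).1
  have : Fintype (Ext.{u} M.obj N.obj 1) := Fintype.ofFinite _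
  have : ∀ E : FDMod k (Principal s), Fintype (Submodule (PathAlgebra k (Principal s)) E.obj) :=
    fun E => have := finite_of_finDim E; Fintype.ofFinite _
  choose c f g w h hx using exists_isoClass_extClass_eq M N
  rw [finsum_epsilon_smul h hx (CC Λ)]
  have hdim : ∀ x, dimZ (c x).out = dimZ N + dimZ M := by
    intro x
    have := finite_of_finDim (c x).out
    have hd := dimVec_add (f x).hom (g x).hom (h x).moduleCat_injective_f
      (h x).moduleCat_surjective_g
      ((ShortComplex.ShortExact.moduleCat_exact_iff_function_exact _).1 (h x).exact)
    funext i
    have hi := congrFun hd i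
    simp only [dimZ, Pi.add_apply] at hi ⊢
    exact_mod_cast hi
  -- The summand of the right-hand side belonging to a submodule of dimension vector `d`.
  let φ : (Principal s → ℕ) → QuantumTorus (sqrtCard k) Λ := fun d =>
    ((sqrtCard k ^ (-eulerForm k (fun i => (d i : ℤ)) (dimZ N + dimZ M - fun i => (d i : ℤ))) :
      (HalfRing k)ˣ) : HalfRing k) • QuantumTorus.X (sqrtCard k) Λ
        (BTilde s *ᵥ (fun i => (d i : ℤ)) - (IRdim N + IRdim M))
  have hE : ∀ x, CC Λ (c x).out =
      ∑ L : Submodule (PathAlgebra k (Principal s)) (c x).out.obj,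
        φ (dimVec (ModuleCat.of (PathAlgebra k (Principal s)) L)) := by
    intro x
    rw [CC_eq_sum]
    refine Finset.sum_congr rfl fun L _ => ?_
    rw [hdim, IRdim, hdim, Matrix.mulVec_add]
    rfl
  have := fun x => finite_of_finDim (c x).out
  rw [Finset.sum_congr rfl fun x _ => hE x, sum_ext_sum_submodule h hx φ, CC_eq_sum, CC_eq_sum,
    Finset.sum_mul_sum, Finset.smul_sum, Finset.smul_sum]
  refine Finset.sum_congr rfl fun U _ => ?_
  rw [Finset.smul_sum, Finset.smul_sum]
  refine Finset.sum_congr rfl fun W _ => ?_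
  obtain ⟨a, ha, ha'⟩ := card_ker_mul_card_hom hQ U W
  rw [ha, ← Nat.cast_smul_eq_nsmul (HalfRing k), Nat.cast_pow, card_pow_eq_sqrtCard_zpow,
    card_pow_eq_sqrtCard_zpow, smul_mul_smul_comm, QuantumTorus.X_mul_X]
  simp only [φ, smul_smul, ← Units.val_mul, ← zpow_add]
  set u : Principal s → ℤ := fun i => (dimVec (ModuleCat.of (PathAlgebra k (Principal s)) U) i : ℤ)
    with hu
  set z : Principal s → ℤ := fun i => (dimVec (ModuleCat.of (PathAlgebra k (Principal s)) W) i : ℤ)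
    with hz
  have huz : (fun i => (((dimVec (ModuleCat.of (PathAlgebra k (Principal s)) U) +
      dimVec (ModuleCat.of (PathAlgebra k (Principal s)) W)) i : ℕ) : ℤ)) = u + z := by
    funext i
    simp [hu, hz]
  have hX : BTilde s *ᵥ u - IRdim N + (BTilde s *ᵥ z - IRdim M) =
      BTilde s *ᵥ (u + z) - (IRdim N + IRdim M) := by
    rw [Matrix.mulVec_add]
    abel
  rw [huz, hX, ha']
  congr 3
  have key := exponent_identity (k := k) hskew hΛ (dimZ M) (dimZ N) z u
  have hn : (fun i => (dimVec N.obj i : ℤ)) = dimZ N := rfl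
  rw [hn]
  simp only [IRdim]
  linear_combination key

end Multiplication

end QuantumCC

theorem mainTheorem1 {k V : Type u} [Field k] [Finite k] [Fintype V] [DecidableEq V]
    [Quiver.{u} V] [∀ i j : V, Finite (i ⟶ j)] (hV : QuantumCC.Acyclic V)
    (s : Finset V) (Λ : Matrix V V ℤ) (hskew : Λᵀ = -Λ)
    (hΛ : Λ * (-QuantumCC.BTilde s) = QuantumCC.ITilde s)
    (M N : QuantumCC.FDMod k (QuantumCC.Principal s)) :
    (Nat.card k : QuantumCC.HalfRing k) ^ QuantumCC.extDim M.obj N.obj •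
        (QuantumCC.CC Λ N * QuantumCC.CC Λ M) =
      ((QuantumCC.sqrtCard k ^ (-QuantumCC.form Λ (QuantumCC.IRdim M) (QuantumCC.IRdim N)) :
          (QuantumCC.HalfRing k)ˣ) : QuantumCC.HalfRing k) •
        ∑ᶠ E : QuantumCC.IsoClass k (QuantumCC.Principal s),
          QuantumCC.epsilon M.obj N.obj E.out.obj • QuantumCC.CC Λ E.out :=
  QuantumCC.card_pow_extDim_smul_CC_mul_CC hV hskew hΛ M N
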